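/- For $\lambda>|q|$ let $v_\lambda(x)=\lambda\,\mathrm{sech}\big(\lambda|x|+\tanh^{-1}(q/\lambda)\big)$, $x\in\mathbb R$. On $L^2(\mathbb R;\mathbb C)$ let $$L_{q+}=\tfrac12\big(1-\partial_x^2-6v_1^2-2q\delta_0\big),\qquad L_{q-}=\tfrac12\big(1-\partial_x^2-2v_1^2-2q\delta_0\big),$$ with common domain the set of $u\in H^2(\mathbb R\setminus\{0\})$ that are continuous at $0$ and satisfy $u'(0+)-u'(0-)=-2q\,u(0)$ (the operators act by $\frac12(u-u''-6v_1^2u)$, resp. $\frac12(u-u''-2v_1^2u)$, away from $0$). Let $$F_q=\begin{bmatrix}0&L_{q-}\\-L_{q+}&0\end{bmatrix}\quad\text{on } L^2(\mathbb R;\mathbb C)^2,$$ which is the complexification of the linearized operator under $w\simeq[\mathrm{Re}\,w,\mathrm{Im}\,w]^t$; in particular write $iv_1=[0,v_1]^t$ and $\partial_\lambda v_\lambda|_{\lambda=1}=[\partial_\lambda v_\lambda|_{\lambda=1},0]^t$. Let $\sigma_3=\mathrm{diag}(1,-1)$. There are constants $q_0,\delta,C>0$ such that for all real $q$ with $0<|q|<q_0$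 the following holds. 1. The generalized kernel $\bigcup_n\ker F_q^n$ is two-dimensional, spanned by $iv_1$ and $\partial_\lambda v_\lambda|_{\lambda=1}$, and $$F_q(iv_1)=0,\qquad F_q\big(\partial_\lambda v_\lambda|_{\lambda=1}\big)=iv_1 .$$ 2. The eigenvalues of $F_q$ in $\{|z|<\delta\}$ are exactly $0$ and two further, nonzero, distinct eigenvalues $i\lambda_q^+$ and $i\lambda_q^-$, where $$\big|\lambda_q^\pm\mp q^{1/2}\big|\le C|q|^{3/2}\ \text{ if } q>0,\qquad \big|\lambda_q^\pm\mp i|q|^{1/2}\big|\le C|q|^{3/2}\ \text{ if } q<0 .$$ (So $\lambda_q^\pm$ are eigenvalues of $-iF_q$.) Both are algebraically simple: their generalized eigenspaces are spanned by eigenfunctions $w_q^\pm\ne0$. 3. The eigenfunctions $w_q^\pm$ are odd and can be chosen so that $\sigma_3w_q^\pm=w_q^\mp$. -/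

import Mathlib

open MeasureTheory Filter Topology

noncomputable section

namespace DeltaNLS

/-- The Hilbert space `L²(ℝ; ℂ)`. -/
abbrev L2 : Type := Lp ℂ 2 (volume : Measure ℝ)

/-- The nonlinear ground state `v_l(x) = l sech(l |x| + artanh(q / l))`. -/
def groundState (q l x : ℝ) : ℝ := l / Real.cosh (l * |x| + Real.artanh (q / l))

/-- `f ∈ H²(ℝ ∖ {0})` with first derivative `f₁` and second derivative `f₂` on `ℝ ∖ {0}`:
all three are in `L²`, `f` is `C¹` off the origin with derivative `f₁`, and `f₁` is locally
absolutely continuous off the origin with derivative `f₂`. -/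
structure IsH2Off (f f₁ f₂ : ℝ → ℂ) : Prop where
  memLp : MemLp f 2 volume
  memLp_one : MemLp f₁ 2 volume
  memLp_two : MemLp f₂ 2 volume
  hasDerivAt : ∀ x : ℝ, x ≠ 0 → HasDerivAt f (f₁ x) x
  sub_eq_integral : ∀ a b : ℝ, (0 : ℝ) ∉ Set.uIcc a b → f₁ b - f₁ a = ∫ t in a..b, f₂ t

/-- The domain of `-∂ₓ² - 2 q δ₀`: functions in `H²(ℝ ∖ {0})`, continuous at `0`, with the jump
condition `f'(0+) - f'(0-) = -2 q f(0)`. -/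
structure InDomain (q : ℝ) (f f₁ f₂ : ℝ → ℂ) : Prop extends IsH2Off f f₁ f₂ where
  continuousAt_zero : ContinuousAt f 0
  jump : ∃ a b : ℂ, Tendsto f₁ (𝓝[>] 0) (𝓝 a) ∧ Tendsto f₁ (𝓝[<] 0) (𝓝 b) ∧
    a - b = -2 * (q : ℂ) * f 0

theorem InDomain.add {q : ℝ} {f f₁ f₂ g g₁ g₂ : ℝ → ℂ} (hf : InDomain q f f₁ f₂)
    (hg : InDomain q g g₁ g₂) :
    InDomain q (fun x => f x + g x) (fun x => f₁ x + g₁ x) (fun x => f₂ x + g₂ x) where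
  memLp := hf.memLp.add hg.memLp
  memLp_one := hf.memLp_one.add hg.memLp_one
  memLp_two := hf.memLp_two.add hg.memLp_two
  hasDerivAt x hx := (hf.hasDerivAt x hx).add (hg.hasDerivAt x hx)
  sub_eq_integral a b h := by
    have i1 : IntervalIntegrable f₂ volume a b :=
      ((hf.memLp_two.locallyIntegrable (by norm_num)).integrableOn_isCompact
        isCompact_uIcc).intervalIntegrable
    have i2 : IntervalIntegrable g₂ volume a b :=
      ((hg.memLp_two.locallyIntegrable (by norm_num)).integrableOn_isCompact
        isCompact_uIcc).intervalIntegrable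
    rw [intervalIntegral.integral_add i1 i2, ← hf.sub_eq_integral a b h,
      ← hg.sub_eq_integral a b h]
    ring
  continuousAt_zero := hf.continuousAt_zero.add hg.continuousAt_zero
  jump := by
    obtain ⟨a, b, ha, hb, hab⟩ := hf.jump
    obtain ⟨c, d, hc, hd, hcd⟩ := hg.jump
    exact ⟨a + c, b + d, ha.add hc, hb.add hd, by linear_combination hab + hcd⟩

theorem InDomain.smul {q : ℝ} {f f₁ f₂ : ℝ → ℂ} (c : ℂ) (hf : InDomain q f f₁ f₂) :
    InDomain q (fun x => c * f x) (fun x => c * f₁ x) (fun x => c * f₂ x) where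
  memLp := hf.memLp.const_mul c
  memLp_one := hf.memLp_one.const_mul c
  memLp_two := hf.memLp_two.const_mul c
  hasDerivAt x hx := (hf.hasDerivAt x hx).const_mul c
  sub_eq_integral a b h := by
    rw [intervalIntegral.integral_const_mul, ← hf.sub_eq_integral a b h]
    ring
  continuousAt_zero := hf.continuousAt_zero.const_mul c
  jump := by
    obtain ⟨a, b, ha, hb, hab⟩ := hf.jump
    exact ⟨c * a, c * b, ha.const_mul c, hb.const_mul c, by linear_combination c * hab⟩

theorem InDomain.zero (q : ℝ) :
    InDomain q (fun _ => 0) (fun _ => 0) (fun _ => 0) where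
  memLp := MemLp.zero'
  memLp_one := MemLp.zero'
  memLp_two := MemLp.zero'
  hasDerivAt x _ := hasDerivAt_const x 0
  sub_eq_integral a b _ := by simp
  continuousAt_zero := continuousAt_const
  jump := ⟨0, 0, tendsto_const_nhds, tendsto_const_nhds, by simp⟩

/-- The graph, in `L² × L²`, of the operator `½ (1 - ∂ₓ² - W - 2 q δ₀)`, acting as
`½ (f - f'' - W f)` away from the origin on functions that satisfy the jump condition. -/
def schrodingerGraph (q : ℝ) (W : ℝ → ℝ) : Submodule ℂ (L2 × L2) where
  carrier := {p | ∃ f f₁ f₂ : ℝ → ℂ, InDomain q f f₁ f₂ ∧ p.1 =ᵐ[volume] f ∧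
    p.2 =ᵐ[volume] fun x => (1 / 2 : ℂ) * (f x - f₂ x - (W x : ℂ) * f x)}
  zero_mem' := by
    refine ⟨_, _, _, InDomain.zero q, Lp.coeFn_zero _ _ _, ?_⟩
    filter_upwards [Lp.coeFn_zero ℂ 2 (volume : Measure ℝ)] with x hx
    simp [hx]
  add_mem' := by
    rintro ⟨u, k⟩ ⟨u', k'⟩ ⟨f, f₁, f₂, hf, hu, hk⟩ ⟨g, g₁, g₂, hg, hu', hk'⟩
    refine ⟨_, _, _, hf.add hg, ?_, ?_⟩
    · filter_upwards [Lp.coeFn_add u u', hu, hu'] with x h1 h2 h3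
      simp only [Prod.mk_add_mk] at *
      rw [h1, Pi.add_apply, h2, h3]
    · filter_upwards [Lp.coeFn_add k k', hk, hk'] with x h1 h2 h3
      simp only [Prod.mk_add_mk] at *
      rw [h1, Pi.add_apply, h2, h3]
      ring
  smul_mem' := by
    rintro c ⟨u, k⟩ ⟨f, f₁, f₂, hf, hu, hk⟩
    refine ⟨_, _, _, hf.smul c, ?_, ?_⟩
    · filter_upwards [Lp.coeFn_smul c u, hu] with x h1 h2
      simp only [Prod.smul_mk] at *
      rw [h1, Pi.smul_apply, h2, smul_eq_mul]
    · filter_upwards [Lp.coeFn_smul c k, hk] with x h1 h2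
      simp only [Prod.smul_mk] at *
      rw [h1, Pi.smul_apply, h2, smul_eq_mul]
      ring

/-- `schrodingerGraph q W` is the graph of an operator. -/
theorem schrodingerGraph_functional (q : ℝ) (W : ℝ → ℝ) (p : L2 × L2)
    (hp : p ∈ schrodingerGraph q W) (h0 : p.1 = 0) : p.2 = 0 := by
  obtain ⟨f, f₁, f₂, hf, hu, hk⟩ := hp
  rw [h0] at hu
  have hfc : Continuous f := continuous_iff_continuousAt.2 fun x => by
    by_cases hx : x = 0
    · rw [hx]; exact hf.continuousAt_zero
    · exact (hf.hasDerivAt x hx).continuousAt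
  have hf0 : f = fun _ => 0 := by
    refine (Continuous.ae_eq_iff_eq volume hfc continuous_const).1 ?_
    filter_upwards [hu, Lp.coeFn_zero ℂ 2 (volume : Measure ℝ)] with x h1 h2
    rw [← h1, h2, Pi.zero_apply]
  have hf1 : ∀ x : ℝ, x ≠ 0 → f₁ x = 0 := fun x hx => by
    have h := hf.hasDerivAt x hx
    rw [hf0] at h
    exact h.unique (hasDerivAt_const x 0)
  have hf2 : ∀ᵐ x : ℝ, f₂ x = 0 := by
    have hne : ∀ᵐ x : ℝ, x ≠ 0 := by simp [ae_iff, measure_singleton]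
    filter_upwards [hne,
      LocallyIntegrable.ae_hasDerivAt_integral
        (hf.memLp_two.locallyIntegrable (by norm_num))] with x hx h
    have h1 : (fun y => ∫ t in x..y, f₂ t) =ᶠ[𝓝 x] fun _ => 0 := by
      obtain ⟨ε, hε, hb⟩ := Metric.isOpen_iff.1 isOpen_ne x hx
      filter_upwards [Metric.ball_mem_nhds x hε] with y hy
      have hsub : Set.uIcc x y ⊆ Metric.ball x ε := by
        rw [← segment_eq_uIcc]
        exact (convex_ball x ε).segment_subset (Metric.mem_ball_self hε) hy
      rw [← hf.sub_eq_integral x y fun h0 => hb (hsub h0) rfl, hf1 x hx, hf1 y (hb hy), sub_zero]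
    exact (h x).unique ((hasDerivAt_const x (0 : ℂ)).congr_of_eventuallyEq h1)
  refine Lp.ext ?_
  filter_upwards [hk, hf2, Lp.coeFn_zero ℂ 2 (volume : Measure ℝ)] with x h1 h2 h3
  rw [h1, h3, h2, hf0]
  simp

/-- The unbounded operator `½ (1 - ∂ₓ² - W - 2 q δ₀)` on `L²(ℝ; ℂ)`. -/
def schrodinger (q : ℝ) (W : ℝ → ℝ) : L2 →ₗ.[ℂ] L2 := (schrodingerGraph q W).toLinearPMap

theorem mem_graph_schrodinger (q : ℝ) (W : ℝ → ℝ) (p : L2 × L2) :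
    p ∈ (schrodinger q W).graph ↔ ∃ f f₁ f₂ : ℝ → ℂ, InDomain q f f₁ f₂ ∧ p.1 =ᵐ[volume] f ∧
      p.2 =ᵐ[volume] fun x => (1 / 2 : ℂ) * (f x - f₂ x - (W x : ℂ) * f x) := by
  rw [schrodinger, Submodule.toLinearPMap_graph_eq _ (schrodingerGraph_functional q W)]
  exact Iff.rfl

/-- `L_{q+} = ½ (1 - ∂ₓ² - 6 v₁² - 2 q δ₀)`. -/
def Lplus (q : ℝ) : L2 →ₗ.[ℂ] L2 := schrodinger q fun x => 6 * groundState q 1 x ^ 2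

/-- `L_{q-} = ½ (1 - ∂ₓ² - 2 v₁² - 2 q δ₀)`. -/
def Lminus (q : ℝ) : L2 →ₗ.[ℂ] L2 := schrodinger q fun x => 2 * groundState q 1 x ^ 2

/-- The linearized operator `F_q (a, b) = (L_{q-} b, -L_{q+} a)` on (complexified) pairs
(real part, imaginary part). -/
def F (q : ℝ) : (L2 × L2) →ₗ.[ℂ] (L2 × L2) where
  domain := (Lplus q).domain.prod (Lminus q).domain
  toFun :=
    { toFun := fun u => (Lminus q ⟨u.1.2, u.2.2⟩, -(Lplus q ⟨u.1.1, u.2.1⟩))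
      map_add' := fun u w => Prod.ext
        ((Lminus q).map_add ⟨u.1.2, u.2.2⟩ ⟨w.1.2, w.2.2⟩)
        ((congrArg Neg.neg ((Lplus q).map_add ⟨u.1.1, u.2.1⟩ ⟨w.1.1, w.2.1⟩)).trans
          (neg_add _ _))
      map_smul' := fun c u => Prod.ext
        ((Lminus q).map_smul c ⟨u.1.2, u.2.2⟩)
        ((congrArg Neg.neg ((Lplus q).map_smul c ⟨u.1.1, u.2.1⟩)).trans
          (smul_neg c _).symm) }

section Spectral

variable {E : Type*} [AddCommGroup E] [Module ℂ E]

/-- `z` is an eigenvalue of the unbounded operator `T`. -/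
def IsEigenvalue (T : E →ₗ.[ℂ] E) (z : ℂ) : Prop :=
  ∃ u : T.domain, (u : E) ≠ 0 ∧ T u = z • (u : E)

/-- `ker (T - z)ⁿ`: it is `0` for `n = 0`, and `u ∈ ker (T - z)ⁿ⁺¹` if and only if `u` is in the
domain of `T` and `T u - z u ∈ ker (T - z)ⁿ`. -/
def kerPow (T : E →ₗ.[ℂ] E) (z : ℂ) : ℕ → Submodule ℂ E
  | 0 => ⊥
  | n + 1 => ((kerPow T z n).comap (T.toFun - z • T.domain.subtype)).map T.domain.subtype

theorem mem_kerPow_succ (T : E →ₗ.[ℂ] E) (z : ℂ) (n : ℕ) (u : E) :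
    u ∈ kerPow T z (n + 1) ↔ ∃ h : u ∈ T.domain, T ⟨u, h⟩ - z • u ∈ kerPow T z n := by
  constructor
  · rintro ⟨⟨w, hw⟩, h, rfl⟩
    exact ⟨hw, h⟩
  · rintro ⟨h, hu⟩
    exact ⟨⟨u, h⟩, hu, rfl⟩

/-- The generalized eigenspace `⋃ₙ ker (T - z)ⁿ`. -/
def genEigenspace (T : E →ₗ.[ℂ] E) (z : ℂ) : Submodule ℂ E := ⨆ n, kerPow T z n

end Spectral

/-- The Pauli matrix `σ₃ = diag(1, -1)`. -/
def sigma3 (u : L2 × L2) : L2 × L2 := (u.1, -u.2)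

/-- Both components are odd functions. -/
def IsOdd (u : L2 × L2) : Prop :=
  ∀ᵐ x : ℝ, u.1 (-x) = -u.1 x ∧ u.2 (-x) = -u.2 x

end DeltaNLS

end

/-!
Away from the origin `-i F_q` acts as the linearization around the soliton `sech` translated by
`artanh q`, whose Jost solutions are elementary: with `k² = 1 - 2 l` and `m² = 1 + 2 l`, where
`Re k, Re m > 0`, the solutions of `F_q u = i l u` that decay at `+∞` are the combinations of
`(jostA k, i jostB k)` and `(jostA m, -i jostB m)`. Splitting a solution into its even and odd
parts, the conditions at the origin become two linear systems for the coefficients. The even one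
is nonsingular for `l ≠ 0`. The odd one only asks that the solution vanish at the origin; its
determinant vanishes, for small `l`, exactly when `k + m = √(4 - 3 q²) - q`, that is when
`l² = q (1 - q²) (√(4 - 3 q²) - q) / 2 ≈ q`.

Simplicity follows from the self-adjointness of `L_{q±}`: if `(F_q - z) u = c r` and `(a, b)` is an
eigenvector for `z`, then the bilinear pairing of `c r` with `(b, a)` vanishes. For the odd
eigenvectors this pairing is `2 c ∫ a b`, and `∫ a b` is a nonzero multiple of the integral of the
square of a real function. For the end `∂_λ v_λ` of the Jordan chain at `0` the pairing is
`c ∫ v_λ ∂_λ v_λ = c`, half of `c` times the derivative of `‖v_λ‖² = 2 (λ - q)`.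
-/

noncomputable section

namespace DeltaNLS

section Hyperbolic

/-- The hyperbolic tangent of a real number, as a complex number. -/
def th (y : ℝ) : ℂ := Real.tanh y

/-- The hyperbolic secant of a real number, as a complex number. -/
def sech (y : ℝ) : ℂ := ((Real.cosh y)⁻¹ : ℝ)

theorem hasDerivAt_tanh (y : ℝ) : HasDerivAt Real.tanh (1 - Real.tanh y ^ 2) y := by
  have hcosh := (Real.cosh_pos y).ne'
  have hquot : Real.tanh = Real.sinh / Real.cosh := funext Real.tanh_eq_sinh_div_cosh
  rw [hquot]
  refine ((Real.hasDerivAt_sinh y).div (Real.hasDerivAt_cosh y) hcosh).congr_deriv ?_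
  simp only [Pi.div_apply]
  field_simp

theorem hasDerivAt_inv_cosh (y : ℝ) :
    HasDerivAt (fun y => (Real.cosh y)⁻¹) (-(Real.tanh y * (Real.cosh y)⁻¹)) y := by
  have hcosh := (Real.cosh_pos y).ne'
  refine ((Real.hasDerivAt_cosh y).inv hcosh).congr_deriv ?_
  rw [Real.tanh_eq_sinh_div_cosh]
  field_simp

theorem hasDerivAt_th (y : ℝ) : HasDerivAt th (1 - th y ^ 2) y :=
  (hasDerivAt_tanh y).ofReal_comp.congr_deriv (by simp [th])

theorem hasDerivAt_sech (y : ℝ) : HasDerivAt sech (-(th y * sech y)) y :=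
  (hasDerivAt_inv_cosh y).ofReal_comp.congr_deriv (by simp [th, sech])

theorem inv_cosh_sq (y : ℝ) : (Real.cosh y)⁻¹ ^ 2 = 1 - Real.tanh y ^ 2 := by
  have hcosh := (Real.cosh_pos y).ne'
  rw [Real.tanh_eq_sinh_div_cosh]
  field_simp
  linarith [Real.cosh_sq y]

theorem sech_sq (y : ℝ) : sech y ^ 2 = 1 - th y ^ 2 := by
  rw [sech, th]
  exact_mod_cast inv_cosh_sq y

theorem sech_eq_mul_exp (y : ℝ) : sech y = (1 + th y) * Complex.exp (-y) := by
  have hreal : (Real.cosh y)⁻¹ = (1 + Real.tanh y) * Real.exp (-y) := by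
    have hcosh := (Real.cosh_pos y).ne'
    rw [Real.tanh_eq_sinh_div_cosh, Real.exp_neg, ← Real.cosh_add_sinh]
    have hexp : Real.cosh y + Real.sinh y ≠ 0 := by
      rw [Real.cosh_add_sinh]
      exact Real.exp_ne_zero y
    field_simp
  rw [sech, th]
  exact_mod_cast hreal

theorem continuous_th : Continuous th :=
  continuous_iff_continuousAt.2 fun y => (hasDerivAt_th y).continuousAt

theorem norm_th_le_one (y : ℝ) : ‖th y‖ ≤ 1 := by
  rw [th, Complex.norm_real]
  exact (Real.abs_tanh_lt_one y).le

theorem norm_one_sub_th_sq_le_one (y : ℝ) : ‖1 - th y ^ 2‖ ≤ 1 := by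
  have hreal : 1 - th y ^ 2 = ((1 - Real.tanh y ^ 2 : ℝ) : ℂ) := by simp [th]
  rw [hreal, Complex.norm_real, Real.norm_eq_abs, abs_le]
  constructor <;> linarith [Real.tanh_sq_lt_one y, sq_nonneg (Real.tanh y)]

theorem th_artanh {t : ℝ} (ht : |t| < 1) : th (Real.artanh t) = t := by
  rw [th, Real.tanh_artanh (abs_lt.1 ht)]

theorem exists_norm_comp_th_le {P : ℂ → ℂ} (hP : Continuous P) : ∃ C, ∀ y, ‖P (th y)‖ ≤ C := by
  obtain ⟨C, hC⟩ := (isCompact_closedBall (0 : ℂ) 1).exists_bound_of_continuousOn hP.continuousOn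
  exact ⟨C, fun y => hC _ (mem_closedBall_zero_iff.2 (norm_th_le_one y))⟩

end Hyperbolic

section ExponentialDecay

/-- A continuous function on the line that decays exponentially at `+∞`, at some positive rate. -/
structure ExpDecay (A : ℝ → ℂ) : Prop where
  continuous : Continuous A
  exists_isBigO : ∃ r > 0, A =O[atTop] fun x => Real.exp (-r * x)

theorem isBigO_exp_neg_mul_of_le {r s : ℝ} (h : s ≤ r) :
    (fun x => Real.exp (-r * x)) =O[atTop] fun x => Real.exp (-s * x) := by
  refine Asymptotics.IsBigO.of_bound 1 ?_
  filter_upwards [eventually_ge_atTop 0] with x hx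
  rw [one_mul, Real.norm_eq_abs, Real.norm_eq_abs, Real.abs_exp, Real.abs_exp]
  gcongr

namespace ExpDecay

variable {A B : ℝ → ℂ}

theorem add (hA : ExpDecay A) (hB : ExpDecay B) : ExpDecay fun x => A x + B x := by
  obtain ⟨r, hr, hAr⟩ := hA.exists_isBigO
  obtain ⟨s, hs, hBs⟩ := hB.exists_isBigO
  exact ⟨hA.continuous.add hB.continuous, min r s, lt_min hr hs,
    (hAr.trans (isBigO_exp_neg_mul_of_le (min_le_left r s))).add
      (hBs.trans (isBigO_exp_neg_mul_of_le (min_le_right r s)))⟩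

theorem const_mul (c : ℂ) (hA : ExpDecay A) : ExpDecay fun x => c * A x := by
  obtain ⟨r, hr, hAr⟩ := hA.exists_isBigO
  exact ⟨hA.continuous.const_mul c, r, hr, hAr.const_mul_left c⟩

theorem sub (hA : ExpDecay A) (hB : ExpDecay B) : ExpDecay fun x => A x - B x := by
  simpa [sub_eq_add_neg] using hA.add (hB.const_mul (-1))

theorem bdd_mul (hA : ExpDecay A) (hB : Continuous B) (hbdd : ∃ C, ∀ x, ‖B x‖ ≤ C) :
    ExpDecay fun x => B x * A x := by
  obtain ⟨r, hr, hAr⟩ := hA.exists_isBigO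
  obtain ⟨C, hC⟩ := hbdd
  have hB_one : B =O[atTop] fun _ => (1 : ℝ) :=
    Asymptotics.IsBigO.of_bound C (Eventually.of_forall fun x => by simpa using hC x)
  exact ⟨hB.mul hA.continuous, r, hr, by simpa using hB_one.mul hAr⟩

theorem comp_th_add_mul {P : ℂ → ℂ} (hP : Continuous P) (c : ℝ) (hA : ExpDecay A) :
    ExpDecay fun x => P (th (x + c)) * A x :=
  hA.bdd_mul (hP.comp (continuous_th.comp (continuous_add_const c)))
    ((exists_norm_comp_th_le hP).imp fun _ hC x => hC (x + c))

theorem comp_add (hA : ExpDecay A) (c : ℝ) : ExpDecay fun x => A (x + c) := by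
  obtain ⟨r, hr, hAr⟩ := hA.exists_isBigO
  refine ⟨hA.continuous.comp (continuous_add_const c), r, hr, ?_⟩
  refine (hAr.comp_tendsto (tendsto_atTop_add_const_right atTop c tendsto_id)).trans
    (Asymptotics.IsBigO.of_bound (Real.exp (-r * c)) (Eventually.of_forall fun x => le_of_eq ?_))
  simp only [Function.comp, id, Real.norm_eq_abs, Real.abs_exp, ← Real.exp_add]
  ring_nf

theorem ofReal_mul (hA : ExpDecay A) : ExpDecay fun x => (x : ℂ) * A x := by
  obtain ⟨r, hr, hAr⟩ := hA.exists_isBigO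
  refine ⟨Complex.continuous_ofReal.mul hA.continuous, r / 2, half_pos hr, ?_⟩
  have hid : (fun x : ℝ => (x : ℂ)) =O[atTop] fun x => Real.exp (r / 2 * x) := by
    refine (Asymptotics.isBigO_of_le _ fun x => ?_).trans
      (isLittleO_pow_exp_pos_mul_atTop 1 (half_pos hr)).isBigO
    simp
  refine (hid.mul hAr).congr_right fun x => ?_
  rw [← Real.exp_add]
  ring_nf

theorem memLp (hA : ExpDecay A) : MemLp A 2 (volume.restrict (Set.Ioi 0)) := by
  obtain ⟨r, hr, hAr⟩ := hA.exists_isBigO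
  rw [memLp_two_iff_integrable_sq_norm hA.continuous.aestronglyMeasurable]
  refine integrable_of_isBigO_exp_neg (b := 2 * r) (by positivity)
    (hA.continuous.norm.pow 2).continuousOn
    ((hAr.norm_left.pow 2).trans (Asymptotics.isBigO_of_le _ fun x => le_of_eq ?_))
  rw [← Real.exp_nat_mul]
  congr 2
  push_cast
  ring

theorem tendsto_atTop (hA : ExpDecay A) : Tendsto A atTop (𝓝 0) := by
  obtain ⟨r, hr, hAr⟩ := hA.exists_isBigO
  exact hAr.trans_tendsto
    (Real.tendsto_exp_atBot.comp (tendsto_id.const_mul_atTop_of_neg (neg_neg_of_pos hr)))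

end ExpDecay

theorem expDecay_exp_neg_mul {k : ℂ} (hk : 0 < k.re) :
    ExpDecay fun y : ℝ => Complex.exp (-(k * y)) := by
  refine ⟨by fun_prop, k.re, hk, Asymptotics.isBigO_of_le _ fun y => le_of_eq ?_⟩
  simp [Complex.norm_exp]

end ExponentialDecay

section TanhExp

open Polynomial

/-- The function `y ↦ p(tanh y) e^{-k y}`. All bound states and Jost solutions of the
Pöschl–Teller potentials `1 - 2 sech²` and `1 - 6 sech²` are of this form. -/
def tanhExp (k : ℂ) (p : ℂ[X]) (y : ℝ) : ℂ := p.eval (th y) * Complex.exp (-(k * y))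

/-- The polynomial `(1 - X²) p' - k p`, to which differentiation of `tanhExp k p` leads because
`tanh' = 1 - tanh²`. -/
def tanhExpDeriv (k : ℂ) (p : ℂ[X]) : ℂ[X] := (1 - X ^ 2) * derivative p - C k * p

theorem eval_tanhExpDeriv (k : ℂ) (p : ℂ[X]) (t : ℂ) :
    (tanhExpDeriv k p).eval t = (1 - t ^ 2) * p.derivative.eval t - k * p.eval t := by
  simp [tanhExpDeriv]

variable {k : ℂ}

theorem hasDerivAt_tanhExp (k : ℂ) (p : ℂ[X]) (y : ℝ) :
    HasDerivAt (tanhExp k p) (tanhExp k (tanhExpDeriv k p) y) y := by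
  have hpoly : HasDerivAt (fun y => p.eval (th y)) (p.derivative.eval (th y) * (1 - th y ^ 2)) y :=
    (p.hasDerivAt (th y)).comp_of_eq y (hasDerivAt_th y) rfl
  have hexp : HasDerivAt (fun y : ℝ => Complex.exp (-(k * y)))
      (Complex.exp (-(k * y)) * -(k * 1)) y :=
    (((hasDerivAt_id y).ofReal_comp.const_mul k).neg).cexp
  refine (hpoly.mul hexp).congr_deriv ?_
  simp only [tanhExp, eval_tanhExpDeriv]
  ring

theorem expDecay_tanhExp (hk : 0 < k.re) (p : ℂ[X]) : ExpDecay (tanhExp k p) :=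
  (expDecay_exp_neg_mul hk).bdd_mul (p.continuous.comp continuous_th)
    (exists_norm_comp_th_le p.continuous)

theorem expDecay_sech : ExpDecay sech := by
  convert expDecay_tanhExp (k := 1) (by norm_num) (1 + X) using 1
  ext y
  simp [tanhExp, sech_eq_mul_exp]

/-- The polynomial factor of `jostA`. -/
def jostPolyA (k : ℂ) : ℂ[X] := C (k ^ 2 - 1) + C (2 * k) * X + C 2 * X ^ 2

/-- The polynomial factor of `jostB`. -/
def jostPolyB (k : ℂ) : ℂ[X] := C (k ^ 2 + 1) + C (2 * k) * X

/-- The first component `(k² + 2 k tanh y + 2 tanh² y - 1) e^{-k y}` of the Jost solution with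
exponent `k` of the linearized system around the unperturbed soliton. -/
def jostA (k : ℂ) : ℝ → ℂ := tanhExp k (jostPolyA k)

/-- The second component `(k² + 2 k tanh y + 1) e^{-k y}` of the Jost solution with exponent `k`
of the linearized system around the unperturbed soliton. -/
def jostB (k : ℂ) : ℝ → ℂ := tanhExp k (jostPolyB k)

/-- The derivative of `jostA k`. -/
def jostA₁ (k : ℂ) : ℝ → ℂ := tanhExp k (tanhExpDeriv k (jostPolyA k))

/-- The derivative of `jostB k`. -/
def jostB₁ (k : ℂ) : ℝ → ℂ := tanhExp k (tanhExpDeriv k (jostPolyB k))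

theorem jostA_apply (k : ℂ) (y : ℝ) :
    jostA k y = (k ^ 2 + 2 * k * th y + 2 * th y ^ 2 - 1) * Complex.exp (-(k * y)) := by
  simp only [jostA, tanhExp, jostPolyA, eval_add, eval_mul, eval_pow, eval_C, eval_X]
  ring

theorem jostB_apply (k : ℂ) (y : ℝ) :
    jostB k y = (k ^ 2 + 1 + 2 * k * th y) * Complex.exp (-(k * y)) := by
  simp [jostB, tanhExp, jostPolyB]

theorem jostA₁_add_mul (k : ℂ) (y : ℝ) : jostA₁ k y + th y * jostA k y =
    (k + th y) * (3 - 2 * th y ^ 2 - k ^ 2) * Complex.exp (-(k * y)) := by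
  simp only [jostA, jostA₁, tanhExp, jostPolyA, eval_tanhExpDeriv, derivative_add, derivative_C_mul,
    derivative_C, derivative_X, derivative_X_sq, eval_add, eval_mul, eval_pow, eval_C, eval_X,
    eval_zero, eval_one]
  ring

theorem jostB₁_add_mul (k : ℂ) (y : ℝ) :
    jostB₁ k y + th y * jostB k y = (1 - k ^ 2) * (k + th y) * Complex.exp (-(k * y)) := by
  simp only [jostB, jostB₁, tanhExp, jostPolyB, eval_tanhExpDeriv, derivative_add, derivative_C_mul,
    derivative_C, derivative_X, eval_add, eval_mul, eval_C, eval_X, eval_zero, eval_one]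
  ring

theorem hasDerivAt_jostA (k : ℂ) (y : ℝ) : HasDerivAt (jostA k) (jostA₁ k y) y :=
  hasDerivAt_tanhExp k _ y

theorem hasDerivAt_jostB (k : ℂ) (y : ℝ) : HasDerivAt (jostB k) (jostB₁ k y) y :=
  hasDerivAt_tanhExp k _ y

theorem hasDerivAt_jostA₁ (k : ℂ) (y : ℝ) : HasDerivAt (jostA₁ k)
    ((1 - 6 * (1 - th y ^ 2)) * jostA k y - (1 - k ^ 2) * jostB k y) y := by
  refine (hasDerivAt_tanhExp k _ y).congr_deriv ?_
  simp only [jostA, jostB, tanhExp, tanhExpDeriv, jostPolyA, jostPolyB, derivative_add,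
    derivative_sub, derivative_mul, derivative_C, derivative_zero, derivative_one, derivative_X,
    derivative_X_sq, eval_add, eval_sub, eval_mul, eval_pow, eval_C, eval_X, eval_zero, eval_one]
  ring

theorem hasDerivAt_jostB₁ (k : ℂ) (y : ℝ) : HasDerivAt (jostB₁ k)
    ((1 - 2 * (1 - th y ^ 2)) * jostB k y - (1 - k ^ 2) * jostA k y) y := by
  refine (hasDerivAt_tanhExp k _ y).congr_deriv ?_
  simp only [jostA, jostB, tanhExp, tanhExpDeriv, jostPolyA, jostPolyB, derivative_add,
    derivative_sub, derivative_mul, derivative_C, derivative_zero, derivative_one, derivative_X,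
    derivative_X_sq, eval_add, eval_sub, eval_mul, eval_pow, eval_C, eval_X, eval_zero, eval_one]
  ring

theorem expDecay_jostA (hk : 0 < k.re) : ExpDecay (jostA k) := expDecay_tanhExp hk _

theorem expDecay_jostB (hk : 0 < k.re) : ExpDecay (jostB k) := expDecay_tanhExp hk _

theorem expDecay_jostA₁ (hk : 0 < k.re) : ExpDecay (jostA₁ k) := expDecay_tanhExp hk _

theorem expDecay_jostB₁ (hk : 0 < k.re) : ExpDecay (jostB₁ k) := expDecay_tanhExp hk _

end TanhExp

section ClassicalDomain

theorem ae_ne_zero : ∀ᵐ x : ℝ, x ≠ 0 := by simp [ae_iff, measure_singleton]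

theorem intervalIntegrable_of_memLp_two {g : ℝ → ℂ} (hg : MemLp g 2 volume) (a b : ℝ) :
    IntervalIntegrable g volume a b :=
  ((hg.locallyIntegrable (by norm_num)).integrableOn_isCompact isCompact_uIcc).intervalIntegrable

theorem sub_eq_integral_of_hasDerivAt_of_ne_zero {f f' : ℝ → ℂ}
    (hf : ∀ x ≠ 0, HasDerivAt f (f' x) x) (hf' : MemLp f' 2 volume) {a b : ℝ}
    (hab : (0 : ℝ) ∉ Set.uIcc a b) : f b - f a = ∫ t in a..b, f' t :=
  (intervalIntegral.integral_eq_sub_of_hasDerivAt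
    (fun x hx => hf x fun hx0 => hab (hx0 ▸ hx)) (intervalIntegrable_of_memLp_two hf' a b)).symm

theorem tendsto_zero_of_memLp_two {f f' : ℝ → ℂ} (hf : ∀ x > 0, HasDerivAt f (f' x) x)
    (hfL : MemLp f 2 (volume.restrict (Set.Ioi 0)))
    (hfL' : MemLp f' 2 (volume.restrict (Set.Ioi 0))) : Tendsto f atTop (𝓝 0) := by
  have hsq : Tendsto (fun x => f x * f x) atTop (𝓝 0) :=
    tendsto_zero_of_hasDerivAt_of_integrableOn_Ioi (a := 0)
      (f' := fun x => f' x * f x + f x * f' x) (fun x hx => (hf x hx).mul (hf x hx))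
      ((hfL'.integrable_mul hfL).add (hfL.integrable_mul hfL')) (hfL.integrable_mul hfL)
  rw [tendsto_zero_iff_norm_tendsto_zero] at hsq ⊢
  simpa using hsq.sqrt

theorem integral_eq_zero_of_hasDerivAt_of_ne {W W' : ℝ → ℂ} {c : ℝ} {L : ℂ}
    (hderiv : ∀ x ≠ c, HasDerivAt W (W' x) x) (hleft : Tendsto W (𝓝[<] c) (𝓝 L))
    (hright : Tendsto W (𝓝[>] c) (𝓝 L)) (hW : Integrable W) (hW' : Integrable W') :
    ∫ x, W' x = 0 := by
  have hIoi : ∫ x in Set.Ioi c, W' x = 0 - L := by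
    have h_infty := tendsto_zero_of_hasDerivAt_of_integrableOn_Ioi
      (fun x hx => hderiv x (ne_of_gt hx)) hW'.integrableOn hW.integrableOn
    simpa only [Pi.one_apply, Pi.zero_apply, mul_one, mul_zero, add_zero] using
      integral_Ioi_deriv_mul_eq_sub (v := 1) (v' := 0)
      (fun x hx => hderiv x (ne_of_gt hx)) (fun x _ => hasDerivAt_const x 1)
      (by simpa using hW'.integrableOn) (by simpa using hright) (by simpa using h_infty)
  have hIic : ∫ x in Set.Iic c, W' x = L - 0 := by
    have h_infty := tendsto_zero_of_hasDerivAt_of_integrableOn_Iic (a := c - 1)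
      (fun x hx => hderiv x (by grind)) hW'.integrableOn hW.integrableOn
    simpa only [Pi.one_apply, Pi.zero_apply, mul_one, mul_zero, add_zero] using
      integral_Iic_deriv_mul_eq_sub (v := 1) (v' := 0)
      (fun x hx => hderiv x (ne_of_lt hx)) (fun x _ => hasDerivAt_const x 1)
      (by simpa using hW'.integrableOn) (by simpa using hleft) (by simpa using h_infty)
  rw [← intervalIntegral.integral_Iic_add_Ioi hW'.integrableOn hW'.integrableOn (b := c), hIoi,
    hIic]
  ring

theorem tendsto_comp_neg_nhdsGT {f : ℝ → ℂ} {b : ℂ} (h : Tendsto f (𝓝[<] 0) (𝓝 b)) :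
    Tendsto (fun x => f (-x)) (𝓝[>] 0) (𝓝 b) := by
  have hneg := tendsto_neg_nhdsGT (a := (0 : ℝ))
  rw [neg_zero] at hneg
  exact h.comp hneg

theorem tendsto_comp_neg_nhdsLT {f : ℝ → ℂ} {b : ℂ} (h : Tendsto f (𝓝[>] 0) (𝓝 b)) :
    Tendsto (fun x => f (-x)) (𝓝[<] 0) (𝓝 b) := by
  have hneg := tendsto_neg_nhdsLT (a := (0 : ℝ))
  rw [neg_zero] at hneg
  exact h.comp hneg

theorem hasDerivAt_comp_neg {f : ℝ → ℂ} {f' : ℂ} {x : ℝ} (h : HasDerivAt f f' (-x)) :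
    HasDerivAt (fun x => f (-x)) (-f') x :=
  (h.scomp x (hasDerivAt_neg x)).congr_deriv (by simp)

/-- Functions in the domain whose second derivative is a classical one off the origin. -/
structure InDomainC2 (q : ℝ) (f f₁ f₂ : ℝ → ℂ) : Prop extends InDomain q f f₁ f₂ where
  hasDerivAt_one : ∀ x : ℝ, x ≠ 0 → HasDerivAt f₁ (f₂ x) x

theorem InDomain.continuous {q : ℝ} {f f₁ f₂ : ℝ → ℂ} (hf : InDomain q f f₁ f₂) :
    Continuous f := by
  rw [continuous_iff_continuousAt]
  intro x
  rcases eq_or_ne x 0 with rfl | hx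
  · exact hf.continuousAt_zero
  · exact (hf.hasDerivAt x hx).continuousAt

theorem InDomain.inDomainC2 {q : ℝ} {f f₁ f₂ h : ℝ → ℂ} (hf : InDomain q f f₁ f₂)
    (hf₂ : f₂ =ᵐ[volume] h) (hh : ∀ x ≠ 0, ContinuousAt h x) : InDomainC2 q f f₁ h := by
  have hmemLp : MemLp h 2 volume := hf.memLp_two.ae_eq hf₂
  have hintegral : ∀ a b : ℝ, (0 : ℝ) ∉ Set.uIcc a b → f₁ b - f₁ a = ∫ t in a..b, h t := by
    intro a b hab
    rw [hf.sub_eq_integral a b hab]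
    exact intervalIntegral.integral_congr_ae (hf₂.mono fun x hx _ => hx)
  refine { hf with
    memLp_two := hmemLp, sub_eq_integral := hintegral, hasDerivAt_one := fun x hx => ?_ }
  have hderiv := intervalIntegral.integral_hasDerivAt_right
    (IntervalIntegrable.refl : IntervalIntegrable h volume x x)
    hmemLp.aestronglyMeasurable.stronglyMeasurableAtFilter (hh x hx)
  refine (hderiv.const_add (f₁ x)).congr_of_eventuallyEq ?_
  obtain ⟨ε, hε, hball⟩ := Metric.isOpen_iff.1 isOpen_ne x hx
  filter_upwards [Metric.ball_mem_nhds x hε] with y hy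
  have huIcc : Set.uIcc x y ⊆ Metric.ball x ε := by
    rw [← segment_eq_uIcc]
    exact (convex_ball x ε).segment_subset (Metric.mem_ball_self hε) hy
  rw [← hintegral x y fun h0 => hball (huIcc h0) rfl]
  ring

namespace InDomainC2

variable {q : ℝ} {f f₁ f₂ g g₁ g₂ : ℝ → ℂ}

theorem comp_neg (hf : InDomainC2 q f f₁ f₂) :
    InDomainC2 q (fun x => f (-x)) (fun x => -f₁ (-x)) (fun x => f₂ (-x)) := by
  have hneg := Measure.measurePreserving_neg (volume : Measure ℝ)
  have hderiv : ∀ x ≠ 0, HasDerivAt (fun x => -f₁ (-x)) (f₂ (-x)) x := fun x hx =>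
    (hasDerivAt_comp_neg (hf.hasDerivAt_one (-x) (neg_ne_zero.2 hx))).neg.congr_deriv (neg_neg _)
  have hf₂ : MemLp (fun x => f₂ (-x)) 2 volume := hf.memLp_two.comp_measurePreserving hneg
  refine ⟨⟨⟨hf.memLp.comp_measurePreserving hneg,
    (hf.memLp_one.comp_measurePreserving hneg).neg, hf₂,
    fun x hx => hasDerivAt_comp_neg (hf.hasDerivAt (-x) (neg_ne_zero.2 hx)),
    fun a b => sub_eq_integral_of_hasDerivAt_of_ne_zero hderiv hf₂⟩,
    (hf.continuous.comp continuous_neg).continuousAt, ?_⟩, hderiv⟩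
  obtain ⟨a, b, ha, hb, hab⟩ := hf.jump
  refine ⟨-b, -a, (tendsto_comp_neg_nhdsGT hb).neg, (tendsto_comp_neg_nhdsLT ha).neg, ?_⟩
  rw [neg_zero]
  linear_combination hab

theorem tendsto_atTop (hf : InDomainC2 q f f₁ f₂) : Tendsto f atTop (𝓝 0) :=
  tendsto_zero_of_memLp_two (fun x hx => hf.hasDerivAt x hx.ne') (hf.memLp.restrict _)
    (hf.memLp_one.restrict _)

theorem tendsto_one_atTop (hf : InDomainC2 q f f₁ f₂) : Tendsto f₁ atTop (𝓝 0) :=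
  tendsto_zero_of_memLp_two (fun x hx => hf.hasDerivAt_one x hx.ne') (hf.memLp_one.restrict _)
    (hf.memLp_two.restrict _)

/-- Green's identity: since the jumps of `f₁` and `g₁` at the origin are the same multiple of
`f 0` and `g 0`, they cancel in the Wronskian. -/
theorem integral_mul_sub_mul_eq_zero (hf : InDomainC2 q f f₁ f₂) (hg : InDomainC2 q g g₁ g₂) :
    ∫ x, (f₂ x * g x - f x * g₂ x) = 0 := by
  obtain ⟨a, b, ha, hb, hab⟩ := hf.jump
  obtain ⟨c, d, hc, hd, hcd⟩ := hg.jump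
  have hf0 := hf.continuousAt_zero.tendsto
  have hg0 := hg.continuousAt_zero.tendsto
  have hleft : Tendsto (fun x => f₁ x * g x - f x * g₁ x) (𝓝[<] 0) (𝓝 (b * g 0 - f 0 * d)) :=
    (hb.mul (hg0.mono_left nhdsWithin_le_nhds)).sub ((hf0.mono_left nhdsWithin_le_nhds).mul hd)
  have hright : Tendsto (fun x => f₁ x * g x - f x * g₁ x) (𝓝[>] 0) (𝓝 (a * g 0 - f 0 * c)) :=
    (ha.mul (hg0.mono_left nhdsWithin_le_nhds)).sub ((hf0.mono_left nhdsWithin_le_nhds).mul hc)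
  have hlimits : a * g 0 - f 0 * c = b * g 0 - f 0 * d := by
    linear_combination g 0 * hab - f 0 * hcd
  refine integral_eq_zero_of_hasDerivAt_of_ne (fun x hx => ?_) hleft (hlimits ▸ hright)
    ((hf.memLp_one.integrable_mul hg.memLp).sub (hf.memLp.integrable_mul hg.memLp_one))
    ((hf.memLp_two.integrable_mul hg.memLp).sub (hf.memLp.integrable_mul hg.memLp_two))
  exact (((hf.hasDerivAt_one x hx).mul (hg.hasDerivAt x hx)).sub
    ((hf.hasDerivAt x hx).mul (hg.hasDerivAt_one x hx))).congr_deriv (by ring)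

end InDomainC2

end ClassicalDomain

section ReflectExt

/-- The even (`ε = 1`) or odd (`ε = -1`) extension to the line of a function on `[0, ∞)`. -/
def reflectExt (ε : ℂ) (A : ℝ → ℂ) (x : ℝ) : ℂ := if 0 ≤ x then A x else ε * A (-x)

variable {ε : ℂ} {A A₁ A₂ : ℝ → ℂ} {x : ℝ}

theorem reflectExt_of_nonneg (hx : 0 ≤ x) : reflectExt ε A x = A x := if_pos hx

theorem reflectExt_of_neg (hx : x < 0) : reflectExt ε A x = ε * A (-x) := if_neg hx.not_ge

theorem hasDerivAt_reflectExt (ε : ℂ) (hA : ∀ x, HasDerivAt A (A₁ x) x) (hx : x ≠ 0) :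
    HasDerivAt (reflectExt ε A) (reflectExt (-ε) A₁ x) x := by
  rcases hx.lt_or_gt with hneg | hpos
  · rw [reflectExt_of_neg hneg]
    refine (((hasDerivAt_comp_neg (hA (-x))).const_mul ε).congr_deriv
      (by ring)).congr_of_eventuallyEq ?_
    filter_upwards [Iio_mem_nhds hneg] with y hy using reflectExt_of_neg hy
  · rw [reflectExt_of_nonneg hpos.le]
    refine (hA x).congr_of_eventuallyEq ?_
    filter_upwards [Ioi_mem_nhds hpos] with y hy using reflectExt_of_nonneg (le_of_lt hy)

theorem memLp_reflectExt (ε : ℂ) (hA : MemLp A 2 (volume.restrict (Set.Ioi 0))) :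
    MemLp (reflectExt ε A) 2 volume := by
  have hpos : MemLp ((Set.Ioi 0).indicator A) 2 volume :=
    (memLp_indicator_iff_restrict measurableSet_Ioi).2 hA
  have hneg : MemLp ((Set.Ioi 0).indicator A ∘ Neg.neg) 2 volume :=
    hpos.comp_measurePreserving (Measure.measurePreserving_neg volume)
  refine (hpos.add (hneg.const_mul ε)).ae_eq ?_
  filter_upwards [ae_ne_zero] with x hx
  rcases hx.lt_or_gt with hx | hx
  · simp [reflectExt_of_neg hx, hx, hx.not_gt]
  · simp [reflectExt_of_nonneg hx.le, hx, hx.not_gt]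

theorem continuous_reflectExt (hA : Continuous A) (h0 : ε * A 0 = A 0) :
    Continuous (reflectExt ε A) := by
  refine Continuous.if_le hA ((hA.comp continuous_neg).const_mul ε) continuous_const
    continuous_id ?_
  rintro x rfl
  simp [h0]

theorem tendsto_reflectExt_nhdsGT (ε : ℂ) (hA : ContinuousAt A 0) :
    Tendsto (reflectExt ε A) (𝓝[>] 0) (𝓝 (A 0)) := by
  refine (hA.tendsto.mono_left nhdsWithin_le_nhds).congr' ?_
  filter_upwards [self_mem_nhdsWithin] with x hx
  exact (reflectExt_of_nonneg (le_of_lt hx)).symm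

theorem tendsto_reflectExt_nhdsLT (ε : ℂ) (hA : ContinuousAt A 0) :
    Tendsto (reflectExt ε A) (𝓝[<] 0) (𝓝 (ε * A 0)) := by
  refine ((tendsto_comp_neg_nhdsLT (hA.tendsto.mono_left nhdsWithin_le_nhds)).const_mul ε).congr' ?_
  filter_upwards [self_mem_nhdsWithin] with x hx
  exact (reflectExt_of_neg hx).symm

theorem inDomainC2_reflectExt {q : ℝ} (hA : ∀ x, HasDerivAt A (A₁ x) x)
    (hA₁ : ∀ x, HasDerivAt A₁ (A₂ x) x) (dA : ExpDecay A) (dA₁ : ExpDecay A₁) (dA₂ : ExpDecay A₂)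
    (h0 : ε * A 0 = A 0) (hjump : A₁ 0 + ε * A₁ 0 = -2 * q * A 0) :
    InDomainC2 q (reflectExt ε A) (reflectExt (-ε) A₁) (reflectExt ε A₂) := by
  have hA₂ := memLp_reflectExt ε dA₂.memLp
  have hderiv : ∀ x ≠ 0, HasDerivAt (reflectExt (-ε) A₁) (reflectExt ε A₂ x) x := fun x hx => by
    simpa using hasDerivAt_reflectExt (-ε) hA₁ hx
  refine ⟨⟨⟨memLp_reflectExt ε dA.memLp, memLp_reflectExt (-ε) dA₁.memLp, hA₂,
    fun x hx => hasDerivAt_reflectExt ε hA hx,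
    fun a b => sub_eq_integral_of_hasDerivAt_of_ne_zero hderiv hA₂⟩,
    (continuous_reflectExt dA.continuous h0).continuousAt, A₁ 0, -ε * A₁ 0,
    tendsto_reflectExt_nhdsGT _ dA₁.continuous.continuousAt,
    tendsto_reflectExt_nhdsLT _ dA₁.continuous.continuousAt, ?_⟩, hderiv⟩
  rw [reflectExt_of_nonneg le_rfl, ← hjump]
  ring

end ReflectExt

section DecayingSolutions

/-- A solution on `(0, ∞)`, decaying at infinity together with its derivative, of the system
`L₊ a = l b`, `L₋ b = l a`, where the potential is that of the soliton `sech` translated by `-x₀`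
and there is no point interaction. The functions `a₁`, `b₁` are the derivatives of `a`, `b`. -/
structure DecayingSolution (l : ℂ) (x₀ : ℝ) (a a₁ b b₁ : ℝ → ℂ) : Prop where
  hasDerivAt_a : ∀ x > 0, HasDerivAt a (a₁ x) x
  hasDerivAt_a₁ : ∀ x > 0,
    HasDerivAt a₁ ((1 - 6 * (1 - th (x + x₀) ^ 2)) * a x - 2 * l * b x) x
  hasDerivAt_b : ∀ x > 0, HasDerivAt b (b₁ x) x
  hasDerivAt_b₁ : ∀ x > 0,
    HasDerivAt b₁ ((1 - 2 * (1 - th (x + x₀) ^ 2)) * b x - 2 * l * a x) x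
  tendsto_a : Tendsto a atTop (𝓝 0)
  tendsto_a₁ : Tendsto a₁ atTop (𝓝 0)
  tendsto_b : Tendsto b atTop (𝓝 0)
  tendsto_b₁ : Tendsto b₁ atTop (𝓝 0)

/-- The vector field of the first order system in `(a, a', b, b')` equivalent to `L₊ a = l b`,
`L₋ b = l a`. -/
def systemField (l : ℂ) (y : ℝ) : ℂ × ℂ × ℂ × ℂ →ₗ[ℂ] ℂ × ℂ × ℂ × ℂ where
  toFun p := (p.2.1, (1 - 6 * (1 - th y ^ 2)) * p.1 - 2 * l * p.2.2.1,
    p.2.2.2, (1 - 2 * (1 - th y ^ 2)) * p.2.2.1 - 2 * l * p.1)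
  map_add' p r := by
    simp only [Prod.fst_add, Prod.snd_add, Prod.mk_add_mk]
    ring_nf
  map_smul' c p := by
    simp only [Prod.smul_fst, Prod.smul_snd, Prod.smul_mk, smul_eq_mul, RingHom.id_apply]
    ring_nf

theorem norm_one_sub_mul_one_sub_th_sq_le (c : ℂ) (y : ℝ) :
    ‖1 - c * (1 - th y ^ 2)‖ ≤ 1 + ‖c‖ := by
  refine (norm_sub_le _ _).trans ?_
  rw [norm_one, norm_mul]
  gcongr
  exact mul_le_of_le_one_right (norm_nonneg c) (norm_one_sub_th_sq_le_one y)

theorem norm_mul_sub_mul_le {α β s r : ℂ} {K M R : ℝ} (hα : ‖α‖ ≤ K) (hβ : ‖β‖ ≤ M)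
    (hs : ‖s‖ ≤ R) (hr : ‖r‖ ≤ R) : ‖α * s - β * r‖ ≤ (K + M) * R := by
  refine (norm_sub_le _ _).trans ?_
  rw [norm_mul, norm_mul, add_mul]
  have := (norm_nonneg α).trans hα
  have := (norm_nonneg β).trans hβ
  gcongr

theorem norm_systemField_le (l : ℂ) (y : ℝ) (p : ℂ × ℂ × ℂ × ℂ) :
    ‖systemField l y p‖ ≤ (7 + 2 * ‖l‖) * ‖p‖ := by
  have hp₁ : ‖p.1‖ ≤ ‖p‖ := norm_fst_le p
  have hp₂ : ‖p.2.1‖ ≤ ‖p‖ := (norm_fst_le p.2).trans (norm_snd_le p)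
  have hp₃ : ‖p.2.2.1‖ ≤ ‖p‖ := (norm_fst_le p.2.2).trans ((norm_snd_le p.2).trans (norm_snd_le p))
  have hp₄ : ‖p.2.2.2‖ ≤ ‖p‖ := (norm_snd_le p.2.2).trans ((norm_snd_le p.2).trans (norm_snd_le p))
  have hcoef : ∀ c : ℂ, ‖c‖ ≤ 6 → ‖1 - c * (1 - th y ^ 2)‖ ≤ 7 := fun c hc =>
    (norm_one_sub_mul_one_sub_th_sq_le c y).trans (by linarith)
  have hl : ‖2 * l‖ ≤ 2 * ‖l‖ := by simp
  have hle : ‖p‖ ≤ (7 + 2 * ‖l‖) * ‖p‖ :=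
    le_mul_of_one_le_left (norm_nonneg p) (by linarith [norm_nonneg l])
  exact max_le (hp₂.trans hle) (max_le
    (norm_mul_sub_mul_le (hcoef 6 (by norm_num)) hl hp₁ hp₃) (max_le
    (hp₄.trans hle) (norm_mul_sub_mul_le (hcoef 2 (by norm_num)) hl hp₃ hp₁)))

theorem lipschitzWith_systemField (l : ℂ) (y : ℝ) :
    LipschitzWith (7 + 2 * ‖l‖).toNNReal (systemField l y) :=
  AddMonoidHomClass.lipschitz_of_bound _ _ (norm_systemField_le l y)

theorem exists_mul_add_mul_eq {a b c d : ℂ} (hdet : a * d - c * b ≠ 0) (u v : ℂ) :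
    ∃ x y : ℂ, x * a + y * c = u ∧ x * b + y * d = v := by
  refine ⟨(u * d - v * c) / (a * d - c * b), (v * a - u * b) / (a * d - c * b), ?_, ?_⟩ <;>
  · rw [div_mul_eq_mul_div, div_mul_eq_mul_div, ← add_div, div_eq_iff hdet]
    ring

namespace DecayingSolution

variable {l : ℂ} {x₀ : ℝ} {a a₁ b b₁ A A₁ B B₁ C C₁ D D₁ : ℝ → ℂ}

theorem add_const_mul (h : DecayingSolution l x₀ a a₁ b b₁) (H : DecayingSolution l x₀ A A₁ B B₁)
    (c : ℂ) :
    DecayingSolution l x₀ (fun x => a x + c * A x) (fun x => a₁ x + c * A₁ x)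
      (fun x => b x + c * B x) (fun x => b₁ x + c * B₁ x) where
  hasDerivAt_a x hx := (h.hasDerivAt_a x hx).add ((H.hasDerivAt_a x hx).const_mul c)
  hasDerivAt_b x hx := (h.hasDerivAt_b x hx).add ((H.hasDerivAt_b x hx).const_mul c)
  hasDerivAt_a₁ x hx :=
    ((h.hasDerivAt_a₁ x hx).add ((H.hasDerivAt_a₁ x hx).const_mul c)).congr_deriv (by ring)
  hasDerivAt_b₁ x hx :=
    ((h.hasDerivAt_b₁ x hx).add ((H.hasDerivAt_b₁ x hx).const_mul c)).congr_deriv (by ring)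
  tendsto_a := by simpa using h.tendsto_a.add (H.tendsto_a.const_mul c)
  tendsto_b := by simpa using h.tendsto_b.add (H.tendsto_b.const_mul c)
  tendsto_a₁ := by simpa using h.tendsto_a₁.add (H.tendsto_a₁.const_mul c)
  tendsto_b₁ := by simpa using h.tendsto_b₁.add (H.tendsto_b₁.const_mul c)

theorem neg_snd (h : DecayingSolution l x₀ a a₁ b b₁) :
    DecayingSolution (-l) x₀ a a₁ (fun x => -b x) (fun x => -b₁ x) where
  hasDerivAt_a := h.hasDerivAt_a
  hasDerivAt_b x hx := (h.hasDerivAt_b x hx).neg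
  hasDerivAt_a₁ x hx := (h.hasDerivAt_a₁ x hx).congr_deriv (by ring)
  hasDerivAt_b₁ x hx := (h.hasDerivAt_b₁ x hx).neg.congr_deriv (by ring)
  tendsto_a := h.tendsto_a
  tendsto_a₁ := h.tendsto_a₁
  tendsto_b := by simpa using h.tendsto_b.neg
  tendsto_b₁ := by simpa using h.tendsto_b₁.neg

theorem wronskian_eq_zero (h : DecayingSolution l x₀ a a₁ b b₁)
    (H : DecayingSolution l x₀ A A₁ B B₁) {x : ℝ} (hx : 0 < x) :
    a₁ x * A x - a x * A₁ x + (b₁ x * B x - b x * B₁ x) = 0 := by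
  set W : ℝ → ℂ := fun x => a₁ x * A x - a x * A₁ x + (b₁ x * B x - b x * B₁ x)
  have hderiv : ∀ y > 0, HasDerivAt W 0 y := fun y hy =>
    ((((h.hasDerivAt_a₁ y hy).mul (H.hasDerivAt_a y hy)).sub
      ((h.hasDerivAt_a y hy).mul (H.hasDerivAt_a₁ y hy))).add
      (((h.hasDerivAt_b₁ y hy).mul (H.hasDerivAt_b y hy)).sub
      ((h.hasDerivAt_b y hy).mul (H.hasDerivAt_b₁ y hy)))).congr_deriv (by ring)
  have hconst : ∀ y > 0, W y = W x := fun y hy =>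
    isOpen_Ioi.is_const_of_deriv_eq_zero isPreconnected_Ioi
      (fun z hz => (hderiv z hz).differentiableAt.differentiableWithinAt)
      (fun z hz => (hderiv z hz).deriv) hy hx
  have hlim : Tendsto W atTop (𝓝 0) := by
    simpa using ((h.tendsto_a₁.mul H.tendsto_a).sub (h.tendsto_a.mul H.tendsto_a₁)).add
      ((h.tendsto_b₁.mul H.tendsto_b).sub (h.tendsto_b.mul H.tendsto_b₁))
  refine tendsto_nhds_unique (tendsto_const_nhds.congr' ?_) hlim
  filter_upwards [eventually_gt_atTop 0] with y hy using (hconst y hy).symm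

theorem hasDerivAt_systemField (h : DecayingSolution l x₀ a a₁ b b₁) {x : ℝ} (hx : 0 < x) :
    HasDerivAt (fun x => (a x, a₁ x, b x, b₁ x))
      (systemField l (x + x₀) (a x, a₁ x, b x, b₁ x)) x :=
  (h.hasDerivAt_a x hx).prodMk ((h.hasDerivAt_a₁ x hx).prodMk
    ((h.hasDerivAt_b x hx).prodMk (h.hasDerivAt_b₁ x hx)))

theorem eq_zero_of_initial_eq_zero (h : DecayingSolution l x₀ a a₁ b b₁) {t : ℝ} (ht : 0 < t)
    (h0 : (a t, a₁ t, b t, b₁ t) = 0) {x : ℝ} (hx : 0 < x) : (a x, a₁ x, b x, b₁ x) = 0 := by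
  refine ODE_solution_unique_of_mem_Ioo (v := fun x => systemField l (x + x₀))
    (s := fun _ => Set.univ) (a := 0) (b := max x t + 1) (t₀ := t)
    (f := fun x => (a x, a₁ x, b x, b₁ x)) (g := fun _ => 0)
    (fun y _ => (lipschitzWith_systemField l (y + x₀)).lipschitzOnWith)
    ⟨ht, by linarith [le_max_right x t]⟩ (fun y hy => ⟨h.hasDerivAt_systemField hy.1, trivial⟩)
    (fun y _ => ⟨?_, trivial⟩) h0 ⟨hx, by linarith [le_max_left x t]⟩
  rw [map_zero]
  exact hasDerivAt_const y 0

/-- The Wronskians of `(a, b)` with two other decaying solutions are two linear equations for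
`(a' t, b' t)`. -/
theorem eq_zero_of_apply_eq_zero (h : DecayingSolution l x₀ a a₁ b b₁)
    (H : DecayingSolution l x₀ A A₁ B B₁) (K : DecayingSolution l x₀ C C₁ D D₁) {t : ℝ}
    (ht : 0 < t) (hdet : A t * D t - C t * B t ≠ 0) (ha : a t = 0) (hb : b t = 0) {x : ℝ}
    (hx : 0 < x) : (a x, a₁ x, b x, b₁ x) = 0 := by
  have hH := h.wronskian_eq_zero H ht
  have hK := h.wronskian_eq_zero K ht
  rw [ha, hb] at hH hK
  have ha₁ : a₁ t = 0 := (mul_eq_zero.1 (by linear_combination D t * hH - B t * hK :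
    (A t * D t - C t * B t) * a₁ t = 0)).resolve_left hdet
  have hb₁ : b₁ t = 0 := (mul_eq_zero.1 (by linear_combination A t * hK - C t * hH :
    (A t * D t - C t * B t) * b₁ t = 0)).resolve_left hdet
  exact h.eq_zero_of_initial_eq_zero ht (by simp [ha, ha₁, hb, hb₁]) hx

theorem exists_eq_combination (h : DecayingSolution l x₀ a a₁ b b₁)
    (H : DecayingSolution l x₀ A A₁ B B₁) (K : DecayingSolution l x₀ C C₁ D D₁) {t : ℝ}
    (ht : 0 < t) (hdet : A t * D t - C t * B t ≠ 0) :
    ∃ c d : ℂ, ∀ x > 0, a x = c * A x + d * C x ∧ a₁ x = c * A₁ x + d * C₁ x ∧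
      b x = c * B x + d * D x ∧ b₁ x = c * B₁ x + d * D₁ x := by
  obtain ⟨c, d, hc, hd⟩ := exists_mul_add_mul_eq hdet (a t) (b t)
  have hzero := fun x => ((h.add_const_mul H (-c)).add_const_mul K (-d)).eq_zero_of_apply_eq_zero
    H K ht hdet (by linear_combination -hc) (by linear_combination -hd) (x := x)
  refine ⟨c, d, fun x hx => ?_⟩
  obtain ⟨ha, ha₁, hb, hb₁⟩ : _ ∧ _ ∧ _ ∧ _ := by simpa only [Prod.mk_eq_zero] using hzero x hx
  exact ⟨by linear_combination ha, by linear_combination ha₁, by linear_combination hb,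
    by linear_combination hb₁⟩

theorem jost {k : ℂ} (hk : 0 < k.re) (hkl : k ^ 2 = 1 - 2 * l) (x₀ : ℝ) :
    DecayingSolution l x₀ (fun x => jostA k (x + x₀)) (fun x => jostA₁ k (x + x₀))
      (fun x => jostB k (x + x₀)) (fun x => jostB₁ k (x + x₀)) where
  hasDerivAt_a x _ := (hasDerivAt_jostA k (x + x₀)).comp_add_const x x₀
  hasDerivAt_b x _ := (hasDerivAt_jostB k (x + x₀)).comp_add_const x x₀
  hasDerivAt_a₁ x _ := ((hasDerivAt_jostA₁ k (x + x₀)).comp_add_const x x₀).congr_deriv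
    (by rw [hkl]; ring)
  hasDerivAt_b₁ x _ := ((hasDerivAt_jostB₁ k (x + x₀)).comp_add_const x x₀).congr_deriv
    (by rw [hkl]; ring)
  tendsto_a := ((expDecay_jostA hk).comp_add x₀).tendsto_atTop
  tendsto_a₁ := ((expDecay_jostA₁ hk).comp_add x₀).tendsto_atTop
  tendsto_b := ((expDecay_jostB hk).comp_add x₀).tendsto_atTop
  tendsto_b₁ := ((expDecay_jostB₁ hk).comp_add x₀).tendsto_atTop

end DecayingSolution

theorem jostA_mul_jostB_add {k m : ℂ} (h : k ^ 2 + m ^ 2 = 2) (y : ℝ) :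
    jostA k y * jostB m y + jostA m y * jostB k y =
      (k + m) / 2 * (k + m + 2 * th y) *
        ((k + m) ^ 2 + 2 * th y * (k + m) + 4 * th y ^ 2 - 4) *
        (Complex.exp (-(k * y)) * Complex.exp (-(m * y))) := by
  simp only [jostA_apply, jostB_apply]
  linear_combination (-(2 * k * m + 2 * th y * (k + m) + 2 * th y ^ 2 + (k ^ 2 + m ^ 2 - 2) / 2)) *
    (Complex.exp (-(k * y)) * Complex.exp (-(m * y))) * h

theorem re_pos_of_norm_sub_one_lt {k : ℂ} (hk : ‖k - 1‖ < 1) : 0 < k.re := by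
  have hre := abs_lt.1 ((Complex.abs_re_le_norm (k - 1)).trans_lt hk)
  rw [Complex.sub_re, Complex.one_re] at hre
  linarith [hre.1]

theorem add_ne_zero_of_norm_lt {z w : ℂ} (h : ‖w‖ < ‖z‖) : z + w ≠ 0 := fun h0 => by
  rw [eq_neg_of_add_eq_zero_left h0, norm_neg] at h
  exact lt_irrefl _ h

theorem jostA_mul_jostB_add_ne_zero {k m : ℂ} (h : k ^ 2 + m ^ 2 = 2) (hk : ‖k - 1‖ ≤ 1 / 8)
    (hm : ‖m - 1‖ ≤ 1 / 8) {y : ℝ} (hy : th y = 1 / 2) :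
    jostA k y * jostB m y + jostA m y * jostB k y ≠ 0 := by
  obtain ⟨d, hd⟩ : ∃ d, k + m = 2 + d := ⟨k + m - 2, by ring⟩
  have hd_norm : ‖d‖ ≤ 1 / 4 := by
    rw [show d = (k - 1) + (m - 1) by linear_combination -hd]
    exact (norm_add_le _ _).trans (by linarith)
  have h5 : ‖5 + d‖ ≤ 6 := (norm_add_le _ _).trans (by rw [Complex.norm_ofNat]; linarith)
  have hfactor : (k + m) / 2 * (k + m + 2 * th y) *
      ((k + m) ^ 2 + 2 * th y * (k + m) + 4 * th y ^ 2 - 4) =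
      (2 + d) / 2 * (3 + d) * (3 + (5 + d) * d) := by
    rw [hd, hy]
    ring
  rw [jostA_mul_jostB_add h, hfactor]
  have h₁ : 2 + d ≠ 0 := add_ne_zero_of_norm_lt (by rw [Complex.norm_ofNat]; linarith)
  have h₂ : 3 + d ≠ 0 := add_ne_zero_of_norm_lt (by rw [Complex.norm_ofNat]; linarith)
  have h₃ : 3 + (5 + d) * d ≠ 0 := add_ne_zero_of_norm_lt (by
    rw [Complex.norm_ofNat, norm_mul]
    nlinarith [norm_nonneg d, norm_nonneg (5 + d)])
  exact mul_ne_zero (mul_ne_zero (mul_ne_zero (div_ne_zero h₁ two_ne_zero) h₂) h₃)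
    (mul_ne_zero (Complex.exp_ne_zero _) (Complex.exp_ne_zero _))

section JostComb

variable {l k m : ℂ}

/-- The first component of the combination with coefficients `c`, `d` of the Jost solutions with
exponents `k` and `m`. -/
def jostCombA (k m c d : ℂ) (x : ℝ) : ℂ := c * jostA k x + d * jostA m x

/-- The second component of the combination with coefficients `c`, `d` of the Jost solutions with
exponents `k` and `m`. The sign is that of `1 - k² = 2 l`, `1 - m² = -2 l`. -/
def jostCombB (k m c d : ℂ) (x : ℝ) : ℂ := c * jostB k x - d * jostB m x

/-- The derivative of `jostCombA k m c d`. -/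
def jostCombA₁ (k m c d : ℂ) (x : ℝ) : ℂ := c * jostA₁ k x + d * jostA₁ m x

/-- The derivative of `jostCombB k m c d`. -/
def jostCombB₁ (k m c d : ℂ) (x : ℝ) : ℂ := c * jostB₁ k x - d * jostB₁ m x

theorem hasDerivAt_jostCombA (k m c d : ℂ) (x : ℝ) :
    HasDerivAt (jostCombA k m c d) (jostCombA₁ k m c d x) x :=
  ((hasDerivAt_jostA k x).const_mul c).add ((hasDerivAt_jostA m x).const_mul d)

theorem hasDerivAt_jostCombB (k m c d : ℂ) (x : ℝ) :
    HasDerivAt (jostCombB k m c d) (jostCombB₁ k m c d x) x :=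
  ((hasDerivAt_jostB k x).const_mul c).sub ((hasDerivAt_jostB m x).const_mul d)

theorem hasDerivAt_jostCombA₁ (hkl : k ^ 2 = 1 - 2 * l) (hml : m ^ 2 = 1 + 2 * l) (c d : ℂ)
    (x : ℝ) : HasDerivAt (jostCombA₁ k m c d)
      ((1 - 6 * (1 - th x ^ 2)) * jostCombA k m c d x - 2 * l * jostCombB k m c d x) x := by
  refine (((hasDerivAt_jostA₁ k x).const_mul c).add
    ((hasDerivAt_jostA₁ m x).const_mul d)).congr_deriv ?_
  rw [hkl, hml, jostCombA, jostCombB]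
  ring

theorem hasDerivAt_jostCombB₁ (hkl : k ^ 2 = 1 - 2 * l) (hml : m ^ 2 = 1 + 2 * l) (c d : ℂ)
    (x : ℝ) : HasDerivAt (jostCombB₁ k m c d)
      ((1 - 2 * (1 - th x ^ 2)) * jostCombB k m c d x - 2 * l * jostCombA k m c d x) x := by
  refine (((hasDerivAt_jostB₁ k x).const_mul c).sub
    ((hasDerivAt_jostB₁ m x).const_mul d)).congr_deriv ?_
  rw [hkl, hml, jostCombA, jostCombB]
  ring

theorem expDecay_jostCombA (hk : 0 < k.re) (hm : 0 < m.re) (c d : ℂ) :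
    ExpDecay (jostCombA k m c d) :=
  ((expDecay_jostA hk).const_mul c).add ((expDecay_jostA hm).const_mul d)

theorem expDecay_jostCombB (hk : 0 < k.re) (hm : 0 < m.re) (c d : ℂ) :
    ExpDecay (jostCombB k m c d) :=
  ((expDecay_jostB hk).const_mul c).sub ((expDecay_jostB hm).const_mul d)

theorem expDecay_jostCombA₁ (hk : 0 < k.re) (hm : 0 < m.re) (c d : ℂ) :
    ExpDecay (jostCombA₁ k m c d) :=
  ((expDecay_jostA₁ hk).const_mul c).add ((expDecay_jostA₁ hm).const_mul d)

theorem expDecay_jostCombB₁ (hk : 0 < k.re) (hm : 0 < m.re) (c d : ℂ) :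
    ExpDecay (jostCombB₁ k m c d) :=
  ((expDecay_jostB₁ hk).const_mul c).sub ((expDecay_jostB₁ hm).const_mul d)

end JostComb

theorem DecayingSolution.exists_eq_jostComb {l k m : ℂ} {x₀ : ℝ} {a a₁ b b₁ : ℝ → ℂ}
    (h : DecayingSolution l x₀ a a₁ b b₁) (hkl : k ^ 2 = 1 - 2 * l) (hml : m ^ 2 = 1 + 2 * l)
    (hk : ‖k - 1‖ ≤ 1 / 8) (hm : ‖m - 1‖ ≤ 1 / 8) (hx₀ : x₀ < Real.artanh (1 / 2)) :
    ∃ c d : ℂ, ∀ x > 0, a x = jostCombA k m c d (x + x₀) ∧ a₁ x = jostCombA₁ k m c d (x + x₀) ∧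
      b x = jostCombB k m c d (x + x₀) ∧ b₁ x = jostCombB₁ k m c d (x + x₀) := by
  have hJ := DecayingSolution.jost (re_pos_of_norm_sub_one_lt (by linarith)) hkl x₀
  have hK := (DecayingSolution.jost (l := -l) (k := m)
    (re_pos_of_norm_sub_one_lt (by linarith)) (by rw [hml]; ring) x₀).neg_snd
  rw [neg_neg] at hK
  have hth : th (Real.artanh (1 / 2)) = 1 / 2 := by
    rw [th_artanh (by norm_num [abs_of_pos])]
    norm_num
  have hdet := jostA_mul_jostB_add_ne_zero (by rw [hkl, hml]; ring) hk hm hth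
  obtain ⟨c, d, hcd⟩ := h.exists_eq_combination hJ hK (sub_pos.2 hx₀) (by
    rw [sub_add_cancel]
    exact fun h0 => hdet (by linear_combination -h0))
  refine ⟨c, d, fun x hx => ?_⟩
  simpa only [jostCombA, jostCombA₁, jostCombB, jostCombB₁, mul_neg, ← sub_eq_add_neg] using
    hcd x hx

end DecayingSolutions

section Linearization

theorem groundState_one (q x : ℝ) :
    (groundState q 1 x : ℂ) = sech (|x| + Real.artanh q) := by
  simp [groundState, sech]

theorem groundState_one_sq (q x : ℝ) :
    (groundState q 1 x : ℂ) ^ 2 = 1 - th (|x| + Real.artanh q) ^ 2 := by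
  rw [groundState_one, sech_sq]

theorem mem_graph_schrodinger_groundState {q c : ℝ} {p : L2 × L2} :
    p ∈ (schrodinger q fun x => c * groundState q 1 x ^ 2).graph ↔
      ∃ f f₁ f₂, InDomain q f f₁ f₂ ∧ p.1 =ᵐ[volume] f ∧ f₂ =ᵐ[volume] fun x =>
        (1 - c * (1 - th (|x| + Real.artanh q) ^ 2)) * f x - 2 * p.2 x := by
  rw [mem_graph_schrodinger]
  refine exists₃_congr fun f f₁ f₂ => and_congr_right fun _ => and_congr_right fun _ =>
    eventually_congr (Eventually.of_forall fun x => ?_)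
  push_cast
  rw [groundState_one_sq]
  constructor <;> intro h
  · linear_combination 2 * h
  · linear_combination 1 / 2 * h

theorem exists_F_eq_iff {q : ℝ} {u w : L2 × L2} :
    (∃ h : u ∈ (F q).domain, F q ⟨u, h⟩ = w) ↔
      (u.1, -w.2) ∈ (Lplus q).graph ∧ (u.2, w.1) ∈ (Lminus q).graph := by
  constructor
  · rintro ⟨h, rfl⟩
    exact ⟨(LinearPMap.mem_graph_iff _).2 ⟨⟨u.1, h.1⟩, rfl, (neg_neg _).symm⟩,
      (LinearPMap.mem_graph_iff _).2 ⟨⟨u.2, h.2⟩, rfl, rfl⟩⟩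
  · obtain ⟨a, b⟩ := u
    rintro ⟨hplus, hminus⟩
    obtain ⟨⟨_, ha⟩, rfl, hfst⟩ := (LinearPMap.mem_graph_iff _).1 hplus
    obtain ⟨⟨_, hb⟩, rfl, hsnd⟩ := (LinearPMap.mem_graph_iff _).1 hminus
    exact ⟨⟨ha, hb⟩, Prod.ext hsnd (neg_eq_iff_eq_neg.2 hfst)⟩

theorem coeFn_smul_add_ae_eq (c : ℂ) {a b : L2} {f g : ℝ → ℂ} (ha : a =ᵐ[volume] f)
    (hb : b =ᵐ[volume] g) : ⇑(c • a + b) =ᵐ[volume] fun x => c * f x + g x := by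
  filter_upwards [Lp.coeFn_add (c • a) b, Lp.coeFn_smul c a, ha, hb] with x hadd hsmul hax hbx
  rw [hadd, Pi.add_apply, hsmul, Pi.smul_apply, hax, hbx, smul_eq_mul]

/-- `(f, g)`, with first derivatives `f₁` and `g₁`, is a classical solution of the equation
`F_q (f, g) = z (f, g) + (ρ₁, ρ₂)`. -/
structure IsClassicalSolution (q : ℝ) (z : ℂ) (ρ₁ ρ₂ f f₁ g g₁ : ℝ → ℂ) : Prop where
  fst : InDomainC2 q f f₁ fun x =>
    (1 - 6 * (1 - th (|x| + Real.artanh q) ^ 2)) * f x + 2 * (z * g x + ρ₂ x)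
  snd : InDomainC2 q g g₁ fun x =>
    (1 - 2 * (1 - th (|x| + Real.artanh q) ^ 2)) * g x - 2 * (z * f x + ρ₁ x)

theorem InDomain.inDomainC2_of_ae_eq {q c : ℝ} {f f₁ f₂ κ : ℝ → ℂ} (hf : InDomain q f f₁ f₂)
    (hf₂ : f₂ =ᵐ[volume] fun x => (1 - c * (1 - th (|x| + Real.artanh q) ^ 2)) * f x + 2 * κ x)
    (hκ : ∀ x ≠ 0, ContinuousAt κ x) :
    InDomainC2 q f f₁ fun x => (1 - c * (1 - th (|x| + Real.artanh q) ^ 2)) * f x + 2 * κ x := by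
  have hth : Continuous fun x => th (|x| + Real.artanh q) :=
    continuous_th.comp (continuous_abs.add continuous_const)
  have hpot : Continuous fun x => (1 - c * (1 - th (|x| + Real.artanh q) ^ 2)) * f x :=
    (continuous_const.sub (continuous_const.mul (continuous_const.sub (hth.pow 2)))).mul
      hf.continuous
  exact hf.inDomainC2 hf₂ fun x hx => hpot.continuousAt.add ((hκ x hx).const_mul 2)

theorem exists_isClassicalSolution {q : ℝ} {z : ℂ} {u r : L2 × L2} {ρ₁ ρ₂ : ℝ → ℂ}
    (hu : ∃ h : u ∈ (F q).domain, F q ⟨u, h⟩ = z • u + r)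
    (hρ₁ : r.1 =ᵐ[volume] ρ₁) (hρ₂ : r.2 =ᵐ[volume] ρ₂)
    (hρ₁c : ∀ x ≠ 0, ContinuousAt ρ₁ x) (hρ₂c : ∀ x ≠ 0, ContinuousAt ρ₂ x) :
    ∃ f f₁ g g₁, u.1 =ᵐ[volume] f ∧ u.2 =ᵐ[volume] g ∧
      IsClassicalSolution q z ρ₁ ρ₂ f f₁ g g₁ := by
  obtain ⟨hplus, hminus⟩ := exists_F_eq_iff.1 hu
  obtain ⟨f, f₁, f₂, hf, huf, hf₂⟩ := mem_graph_schrodinger_groundState.1 hplus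
  obtain ⟨g, g₁, g₂, hg, hug, hg₂⟩ := mem_graph_schrodinger_groundState.1 hminus
  have hfst : InDomainC2 q f f₁ fun x => (1 - (6 : ℝ) * (1 - th (|x| + Real.artanh q) ^ 2)) * f x +
      2 * (z * g x + ρ₂ x) := by
    refine hf.inDomainC2_of_ae_eq ?_ fun x hx => (hg.continuous.continuousAt.const_mul z).add
      (hρ₂c x hx)
    filter_upwards [hf₂, Lp.coeFn_neg (z • u + r).2, coeFn_smul_add_ae_eq z hug hρ₂]
      with x h₂ hneg hw
    rw [h₂, hneg, Pi.neg_apply, Prod.snd_add, Prod.smul_snd, hw]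
    ring
  have hsnd : InDomainC2 q g g₁ fun x => (1 - (2 : ℝ) * (1 - th (|x| + Real.artanh q) ^ 2)) * g x +
      2 * -(z * f x + ρ₁ x) := by
    refine hg.inDomainC2_of_ae_eq ?_ fun x hx => ((hf.continuous.continuousAt.const_mul z).add
      (hρ₁c x hx)).neg
    filter_upwards [hg₂, coeFn_smul_add_ae_eq z huf hρ₁] with x h₂ hw
    rw [h₂, Prod.fst_add, Prod.smul_fst, hw]
    ring
  refine ⟨f, f₁, g, g₁, huf, hug, ⟨by exact_mod_cast hfst, ?_⟩⟩
  simpa only [mul_neg, ← sub_eq_add_neg, Complex.ofReal_ofNat] using hsnd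

namespace IsClassicalSolution

variable {q : ℝ} {z l : ℂ} {ρ₁ ρ₂ f f₁ g g₁ : ℝ → ℂ}

theorem exists_F_eq {u r : L2 × L2} (h : IsClassicalSolution q z ρ₁ ρ₂ f f₁ g g₁)
    (huf : u.1 =ᵐ[volume] f) (hug : u.2 =ᵐ[volume] g)
    (hρ₁ : r.1 =ᵐ[volume] ρ₁) (hρ₂ : r.2 =ᵐ[volume] ρ₂) :
    ∃ h : u ∈ (F q).domain, F q ⟨u, h⟩ = z • u + r := by
  refine exists_F_eq_iff.2 ⟨mem_graph_schrodinger_groundState.2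
    ⟨_, _, _, h.fst.toInDomain, huf, ?_⟩, mem_graph_schrodinger_groundState.2
    ⟨_, _, _, h.snd.toInDomain, hug, ?_⟩⟩
  · filter_upwards [Lp.coeFn_neg (z • u + r).2, coeFn_smul_add_ae_eq z hug hρ₂] with x hneg hw
    rw [hneg, Pi.neg_apply, Prod.snd_add, Prod.smul_snd, hw]
    push_cast
    ring
  · filter_upwards [coeFn_smul_add_ae_eq z huf hρ₁] with x hw
    rw [Prod.fst_add, Prod.smul_fst, hw]
    push_cast
    ring

theorem comp_neg (h : IsClassicalSolution q z 0 0 f f₁ g g₁) :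
    IsClassicalSolution q z 0 0 (fun x => f (-x)) (fun x => -f₁ (-x)) (fun x => g (-x))
      (fun x => -g₁ (-x)) where
  fst := by simpa using h.fst.comp_neg
  snd := by simpa using h.snd.comp_neg

theorem decayingSolution (h : IsClassicalSolution q (Complex.I * l) 0 0 f f₁ g g₁) :
    DecayingSolution l (Real.artanh q) f f₁ (fun x => -Complex.I * g x)
      (fun x => -Complex.I * g₁ x) where
  hasDerivAt_a x hx := h.fst.hasDerivAt x hx.ne'
  hasDerivAt_b x hx := (h.snd.hasDerivAt x hx.ne').const_mul _
  hasDerivAt_a₁ x hx := (h.fst.hasDerivAt_one x hx.ne').congr_deriv (by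
    rw [abs_of_pos hx, Pi.zero_apply]
    ring)
  hasDerivAt_b₁ x hx := ((h.snd.hasDerivAt_one x hx.ne').const_mul _).congr_deriv (by
    rw [abs_of_pos hx, Pi.zero_apply]
    linear_combination 2 * l * f x * Complex.I_sq)
  tendsto_a := h.fst.tendsto_atTop
  tendsto_b := by simpa using h.snd.tendsto_atTop.const_mul (-Complex.I)
  tendsto_a₁ := h.fst.tendsto_one_atTop
  tendsto_b₁ := by simpa using h.snd.tendsto_one_atTop.const_mul (-Complex.I)

/-- The solvability condition: the adjoint of `F_q - z` annihilates the pair `(b, a)`, because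
`L_{q±}` are self-adjoint. -/
theorem integral_mul_add_mul_eq_zero {a a₁ b b₁ : ℝ → ℂ}
    (h : IsClassicalSolution q z ρ₁ ρ₂ f f₁ g g₁) (H : IsClassicalSolution q z 0 0 a a₁ b b₁) :
    ∫ x, (ρ₁ x * b x + ρ₂ x * a x) = 0 := by
  have hsub := integral_sub
    ((h.fst.memLp_two.integrable_mul H.fst.memLp).sub
      (h.fst.memLp.integrable_mul H.fst.memLp_two))
    ((h.snd.memLp_two.integrable_mul H.snd.memLp).sub
      (h.snd.memLp.integrable_mul H.snd.memLp_two))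
  simp only [Pi.sub_apply, Pi.mul_apply] at hsub
  rw [h.fst.integral_mul_sub_mul_eq_zero H.fst, h.snd.integral_mul_sub_mul_eq_zero H.snd,
    sub_zero] at hsub
  refine mul_left_cancel₀ (two_ne_zero (α := ℂ)) ?_
  rw [mul_zero, ← hsub, ← integral_const_mul]
  congr 1 with x
  simp only [Pi.zero_apply]
  ring

end IsClassicalSolution

end Linearization

section Matching

/-- The combination of Jost solutions with coefficients `e`, `d`, translated by `artanh q` and
extended evenly to the line, satisfies the jump condition at the origin. -/
structure EvenMatching (q : ℝ) (k m e d : ℂ) : Prop where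
  fst : jostCombA₁ k m e d (Real.artanh q) + q * jostCombA k m e d (Real.artanh q) = 0
  snd : jostCombB₁ k m e d (Real.artanh q) + q * jostCombB k m e d (Real.artanh q) = 0

/-- The combination of Jost solutions with coefficients `o`, `p`, translated by `artanh q` and
extended oddly to the line, is continuous at the origin. -/
structure OddMatching (q : ℝ) (k m o p : ℂ) : Prop where
  fst : jostCombA k m o p (Real.artanh q) = 0
  snd : jostCombB k m o p (Real.artanh q) = 0

theorem eq_apply_zero_of_tendsto_nhdsGT {f A : ℝ → ℂ} {α : ℂ} (hf : Tendsto f (𝓝[>] 0) (𝓝 α))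
    (hA : Continuous A) (h : ∀ x > 0, f x = A x) : α = A 0 := by
  refine tendsto_nhds_unique hf (((hA.tendsto 0).mono_left nhdsWithin_le_nhds).congr' ?_)
  filter_upwards [self_mem_nhdsWithin] with x hx using (h x hx).symm

variable {q : ℝ} {l k m : ℂ} {f f₁ g g₁ : ℝ → ℂ}

theorem IsClassicalSolution.exists_eq_jostComb
    (h : IsClassicalSolution q (Complex.I * l) 0 0 f f₁ g g₁) {α β : ℂ}
    (hα : Tendsto f₁ (𝓝[>] 0) (𝓝 α)) (hβ : Tendsto g₁ (𝓝[>] 0) (𝓝 β))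
    (hkl : k ^ 2 = 1 - 2 * l) (hml : m ^ 2 = 1 + 2 * l)
    (hk : ‖k - 1‖ ≤ 1 / 8) (hm : ‖m - 1‖ ≤ 1 / 8) (hq : |q| < 1 / 2) :
    ∃ c d : ℂ, α = jostCombA₁ k m c d (Real.artanh q) ∧
      -Complex.I * β = jostCombB₁ k m c d (Real.artanh q) ∧
      ∀ x ≥ 0, f x = jostCombA k m c d (x + Real.artanh q) ∧
        -Complex.I * g x = jostCombB k m c d (x + Real.artanh q) := by
  have hy : Real.artanh q < Real.artanh (1 / 2) :=
    Real.artanh_lt_artanh (by linarith [neg_lt_of_abs_lt hq]) (by norm_num) (lt_of_abs_lt hq)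
  have hkre := re_pos_of_norm_sub_one_lt (k := k) (by linarith)
  have hmre := re_pos_of_norm_sub_one_lt (k := m) (by linarith)
  obtain ⟨c, d, hcd⟩ := h.decayingSolution.exists_eq_jostComb hkl hml hk hm hy
  have hf0 := h.fst.continuousAt_zero.tendsto.mono_left (nhdsWithin_le_nhds (s := Set.Ioi 0))
  have hg0 := h.snd.continuousAt_zero.tendsto.mono_left (nhdsWithin_le_nhds (s := Set.Ioi 0))
  have hA := eq_apply_zero_of_tendsto_nhdsGT hf0
    ((expDecay_jostCombA hkre hmre c d).comp_add _).continuous fun x hx => (hcd x hx).1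
  have hA₁ := eq_apply_zero_of_tendsto_nhdsGT hα
    ((expDecay_jostCombA₁ hkre hmre c d).comp_add _).continuous fun x hx => (hcd x hx).2.1
  have hB := eq_apply_zero_of_tendsto_nhdsGT (hg0.const_mul (-Complex.I))
    ((expDecay_jostCombB hkre hmre c d).comp_add _).continuous fun x hx => (hcd x hx).2.2.1
  have hB₁ := eq_apply_zero_of_tendsto_nhdsGT (hβ.const_mul (-Complex.I))
    ((expDecay_jostCombB₁ hkre hmre c d).comp_add _).continuous fun x hx => (hcd x hx).2.2.2
  simp only [zero_add] at hA₁ hB₁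
  refine ⟨c, d, hA₁, hB₁, fun x hx => ?_⟩
  rcases hx.eq_or_lt with rfl | hx
  · exact ⟨hA, hB⟩
  · exact ⟨(hcd x hx).1, (hcd x hx).2.2.1⟩

/-- A combination of Jost solutions to the right of the origin and another one to its left are the
sum of an even and an odd extension, to which the conditions at the origin apply separately. -/
theorem IsClassicalSolution.exists_matching
    (h : IsClassicalSolution q (Complex.I * l) 0 0 f f₁ g g₁)
    (hkl : k ^ 2 = 1 - 2 * l) (hml : m ^ 2 = 1 + 2 * l)
    (hk : ‖k - 1‖ ≤ 1 / 8) (hm : ‖m - 1‖ ≤ 1 / 8) (hq : |q| < 1 / 2) :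
    ∃ e d o p : ℂ, EvenMatching q k m e d ∧ OddMatching q k m o p ∧ ∀ x,
      f x = reflectExt 1 (fun x => jostCombA k m e d (x + Real.artanh q)) x +
        reflectExt (-1) (fun x => jostCombA k m o p (x + Real.artanh q)) x ∧
      g x = Complex.I * (reflectExt 1 (fun x => jostCombB k m e d (x + Real.artanh q)) x +
        reflectExt (-1) (fun x => jostCombB k m o p (x + Real.artanh q)) x) := by
  obtain ⟨a, b, ha, hb, hab⟩ := h.fst.jump
  obtain ⟨α, β, hα, hβ, hαβ⟩ := h.snd.jump
  obtain ⟨c, d, hA₁, hB₁, hright⟩ := h.exists_eq_jostComb ha hα hkl hml hk hm hq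
  obtain ⟨c', d', hA₁', hB₁', hleft⟩ := h.comp_neg.exists_eq_jostComb
    (tendsto_comp_neg_nhdsGT hb).neg (tendsto_comp_neg_nhdsGT hβ).neg hkl hml hk hm hq
  obtain ⟨hA, hB⟩ := hright 0 le_rfl
  obtain ⟨hA', hB'⟩ := hleft 0 le_rfl
  simp only [neg_zero, zero_add, jostCombA, jostCombB, jostCombA₁, jostCombB₁] at *
  refine ⟨(c + c') / 2, (d + d') / 2, (c - c') / 2, (d - d') / 2, ⟨?_, ?_⟩, ⟨?_, ?_⟩,
    fun x => ?_⟩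
  · rw [jostCombA, jostCombA₁]
    linear_combination (-1 / 2) * (hA₁ + hA₁') + 1 / 2 * hab - q / 2 * (hA + hA')
  · rw [jostCombB, jostCombB₁]
    linear_combination (-1 / 2) * (hB₁ + hB₁') - Complex.I / 2 * hαβ - q / 2 * (hB + hB')
  · rw [jostCombA]
    linear_combination (-1 / 2) * hA + 1 / 2 * hA'
  · rw [jostCombB]
    linear_combination (-1 / 2) * hB + 1 / 2 * hB'
  · rcases lt_or_ge x 0 with hx | hx
    · obtain ⟨hfx, hgx⟩ := hleft (-x) (neg_nonneg.2 hx.le)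
      rw [neg_neg] at hfx hgx
      simp only [reflectExt_of_neg hx]
      exact ⟨by linear_combination hfx,
        by linear_combination Complex.I * hgx + g x * Complex.I_sq⟩
    · obtain ⟨hfx, hgx⟩ := hright x hx
      simp only [reflectExt_of_nonneg hx]
      exact ⟨by linear_combination hfx,
        by linear_combination Complex.I * hgx + g x * Complex.I_sq⟩

end Matching

section DispersionRelation

theorem ne_zero_of_norm_sub_lt {z w : ℂ} (h : ‖z - w‖ < ‖w‖) : z ≠ 0 := by
  simpa using add_ne_zero_of_norm_lt h

theorem exists_sq_eq_one_add (w : ℂ) : ∃ k : ℂ, k ^ 2 = 1 + w ∧ ‖k - 1‖ ≤ ‖w‖ := by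
  obtain ⟨k, hk, hre⟩ : ∃ k : ℂ, k ^ 2 = 1 + w ∧ 0 ≤ k.re := by
    obtain ⟨k, hk⟩ := IsAlgClosed.exists_pow_nat_eq (1 + w) (n := 2) (by norm_num)
    rcases le_total 0 k.re with h | h
    · exact ⟨k, hk, h⟩
    · exact ⟨-k, by rw [neg_sq, hk], by simpa using h⟩
  refine ⟨k, hk, ?_⟩
  have hfactor : w = (k - 1) * (k + 1) := by linear_combination -hk
  have hge : 1 ≤ ‖k + 1‖ := by
    have hre_le := (le_abs_self _).trans (Complex.abs_re_le_norm (k + 1))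
    rw [Complex.add_re, Complex.one_re] at hre_le
    linarith
  rw [hfactor, norm_mul]
  exact le_mul_of_one_le_right (norm_nonneg _) hge

theorem exists_exponents {l : ℂ} (hl : ‖l‖ ≤ 1 / 16) : ∃ k m : ℂ, k ^ 2 = 1 - 2 * l ∧
    m ^ 2 = 1 + 2 * l ∧ ‖k - 1‖ ≤ 1 / 8 ∧ ‖m - 1‖ ≤ 1 / 8 := by
  obtain ⟨k, hkl, hk⟩ := exists_sq_eq_one_add (-(2 * l))
  obtain ⟨m, hml, hm⟩ := exists_sq_eq_one_add (2 * l)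
  rw [norm_neg, norm_mul, Complex.norm_ofNat] at hk
  rw [norm_mul, Complex.norm_ofNat] at hm
  exact ⟨k, m, by rw [hkl, sub_eq_add_neg], hml, by linarith, by linarith⟩

theorem norm_add_sub_two_le {k m : ℂ} (hk : ‖k - 1‖ ≤ 1 / 8) (hm : ‖m - 1‖ ≤ 1 / 8) :
    ‖k + m - 2‖ ≤ 1 / 4 := by
  rw [show k + m - 2 = (k - 1) + (m - 1) by ring]
  exact (norm_add_le _ _).trans (by linarith)

/-- The root near `2` of `X² + 2 q X + 4 q² - 4`. The odd matching conditions have a nonzero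
solution when the sum of the two exponents takes this value. -/
def exponentSum (q : ℝ) : ℝ := √(4 - 3 * q ^ 2) - q

/-- The square of the two nonzero eigenvalues of `-i F_q` near the origin. -/
def eigSq (q : ℝ) : ℝ := q * (1 - q ^ 2) * exponentSum q / 2

variable {q : ℝ}

theorem exponentSum_quadratic (hq : |q| < 1 / 100) :
    exponentSum q ^ 2 + 2 * q * exponentSum q + 4 * q ^ 2 - 4 = 0 := by
  rw [abs_lt] at hq
  rw [exponentSum]
  linear_combination Real.sq_sqrt (by nlinarith : 0 ≤ 4 - 3 * q ^ 2)

theorem sixteen_mul_eigSq (hq : |q| < 1 / 100) :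
    16 * eigSq q = exponentSum q ^ 2 * (4 - exponentSum q ^ 2) := by
  rw [eigSq]
  linear_combination (exponentSum q ^ 2 - 2 * q * exponentSum q) * exponentSum_quadratic hq

theorem abs_exponentSum_sub_two_le (hq : |q| < 1 / 100) : |exponentSum q - 2| ≤ 2 * |q| := by
  have habs := abs_nonneg q
  have hsq := sq_abs q
  have hle : √(4 - 3 * q ^ 2) ≤ 2 :=
    Real.sqrt_le_iff.2 ⟨by norm_num, by linarith [sq_nonneg q]⟩
  have hge : 2 - |q| ≤ √(4 - 3 * q ^ 2) := Real.le_sqrt_of_sq_le (by nlinarith)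
  rw [exponentSum, abs_le]
  constructor <;> linarith [le_abs_self q, neg_abs_le q]

theorem norm_exponentSum_sub_two_le (hq : |q| < 1 / 100) : ‖(exponentSum q : ℂ) - 2‖ ≤ 1 / 4 := by
  rw [show (exponentSum q : ℂ) - 2 = ((exponentSum q - 2 : ℝ) : ℂ) by push_cast; rfl,
    Complex.norm_real]
  exact (abs_exponentSum_sub_two_le hq).trans (by linarith)

theorem abs_eigSq_sub_le (hq : |q| < 1 / 100) : |eigSq q - q| ≤ 2 * q ^ 2 := by
  have hfactor : eigSq q - q = q * ((1 - q ^ 2) * (exponentSum q - 2) / 2 - q ^ 2) := by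
    rw [eigSq]
    ring
  have hle : |(1 - q ^ 2) * (exponentSum q - 2) / 2 - q ^ 2| ≤ 2 * |q| := by
    have hsum := abs_le.1 (abs_exponentSum_sub_two_le hq)
    rw [abs_le]
    constructor <;> nlinarith [abs_nonneg q, sq_abs q, sq_nonneg q]
  calc |eigSq q - q| = |q| * |(1 - q ^ 2) * (exponentSum q - 2) / 2 - q ^ 2| := by
        rw [hfactor, abs_mul]
    _ ≤ |q| * (2 * |q|) := by gcongr
    _ = 2 * q ^ 2 := by rw [← sq_abs q]; ring

theorem eigSq_pos (hq : |q| < 1 / 100) (hpos : 0 < q) : 0 < eigSq q := by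
  have hle := abs_le.1 (abs_eigSq_sub_le hq)
  rw [abs_of_pos hpos] at hq
  nlinarith [hle.1]

theorem eigSq_neg (hq : |q| < 1 / 100) (hneg : q < 0) : eigSq q < 0 := by
  have hle := abs_le.1 (abs_eigSq_sub_le hq)
  rw [abs_of_neg hneg] at hq
  nlinarith [hle.2]

theorem eigSq_ne_zero (hq : |q| < 1 / 100) (h0 : q ≠ 0) : eigSq q ≠ 0 := by
  rcases h0.lt_or_gt with hneg | hpos
  · exact (eigSq_neg hq hneg).ne
  · exact (eigSq_pos hq hpos).ne'

theorem abs_sqrt_abs_eigSq_sub_le (hq : |q| < 1 / 100) :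
    |√(|eigSq q|) - √(|q|)| ≤ 2 * |q| ^ (3 / 2 : ℝ) := by
  rcases eq_or_ne q 0 with rfl | h0
  · simp [eigSq]
  have hpos := abs_pos.2 h0
  have hrpow : |q| ^ (3 / 2 : ℝ) * √(|q|) = q ^ 2 := by
    rw [Real.sqrt_eq_rpow, ← Real.rpow_add hpos, ← sq_abs, ← Real.rpow_natCast]
    norm_num
  have hfactor : (√(|eigSq q|) - √(|q|)) * (√(|eigSq q|) + √(|q|)) = |eigSq q| - |q| := by
    linear_combination Real.sq_sqrt (abs_nonneg (eigSq q)) - Real.sq_sqrt (abs_nonneg q)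
  refine le_of_mul_le_mul_right ?_ (Real.sqrt_pos.2 hpos)
  calc |√(|eigSq q|) - √(|q|)| * √(|q|)
      ≤ |√(|eigSq q|) - √(|q|)| * (√(|eigSq q|) + √(|q|)) := by
        gcongr
        exact le_add_of_nonneg_left (Real.sqrt_nonneg _)
    _ = |(|eigSq q| - |q|)| := by
        rw [← hfactor, abs_mul, abs_of_nonneg (by positivity : 0 ≤ √(|eigSq q|) + √(|q|))]
    _ ≤ 2 * q ^ 2 := (abs_abs_sub_abs_le_abs_sub _ _).trans (abs_eigSq_sub_le hq)
    _ = 2 * |q| ^ (3 / 2 : ℝ) * √(|q|) := by rw [mul_assoc, hrpow]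

theorem norm_sq_sub_four_le {z : ℂ} (hz : ‖z - 2‖ ≤ 1 / 4) : ‖z ^ 2 - 4‖ ≤ 17 / 16 := by
  rw [show z ^ 2 - 4 = (z - 2) * ((z - 2) + 4) by ring, norm_mul]
  have hadd : ‖z - 2 + 4‖ ≤ 17 / 4 :=
    (norm_add_le _ _).trans (by rw [Complex.norm_ofNat]; linarith)
  calc ‖z - 2‖ * ‖z - 2 + 4‖ ≤ 1 / 4 * (17 / 4) := by gcongr
    _ = 17 / 16 := by norm_num

theorem eq_of_sq_mul_four_sub_sq_eq {z w : ℂ} (hz : ‖z - 2‖ ≤ 1 / 4) (hw : ‖w - 2‖ ≤ 1 / 4)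
    (h : z ^ 2 * (4 - z ^ 2) = w ^ 2 * (4 - w ^ 2)) : z = w := by
  have hfactor : (z - w) * ((z + w) * (z ^ 2 + w ^ 2 - 4)) = 0 := by linear_combination -h
  have hsum : z + w ≠ 0 := ne_zero_of_norm_sub_lt (w := 4) (by
    rw [show z + w - 4 = (z - 2) + (w - 2) by ring, Complex.norm_ofNat]
    exact (norm_add_le _ _).trans_lt (by linarith))
  have hsq : z ^ 2 + w ^ 2 - 4 ≠ 0 := ne_zero_of_norm_sub_lt (w := 4) (by
    rw [show z ^ 2 + w ^ 2 - 4 - 4 = (z ^ 2 - 4) + (w ^ 2 - 4) by ring, Complex.norm_ofNat]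
    exact (norm_add_le _ _).trans_lt
      (by linarith [norm_sq_sub_four_le hz, norm_sq_sub_four_le hw]))
  exact sub_eq_zero.1 ((mul_eq_zero.1 hfactor).resolve_right (mul_ne_zero hsum hsq))

theorem quadratic_eq_zero_iff (hq : |q| < 1 / 100) {z : ℂ} (hz : ‖z - 2‖ ≤ 1 / 4) :
    z ^ 2 + 2 * q * z + 4 * q ^ 2 - 4 = 0 ↔ z = exponentSum q := by
  have hroot : (exponentSum q : ℂ) ^ 2 + 2 * q * exponentSum q + 4 * q ^ 2 - 4 = 0 := by
    exact_mod_cast exponentSum_quadratic hq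
  have hqn : ‖(2 * q : ℂ)‖ ≤ 1 / 4 := by
    rw [norm_mul, Complex.norm_ofNat, Complex.norm_real, Real.norm_eq_abs]
    linarith
  have hother : z + exponentSum q + 2 * q ≠ 0 := ne_zero_of_norm_sub_lt (w := 4) (by
    rw [show z + exponentSum q + 2 * q - 4 = (z - 2) + (exponentSum q - 2) + 2 * q by ring,
      Complex.norm_ofNat]
    exact (norm_add₃_le).trans_lt (by linarith [norm_exponentSum_sub_two_le hq]))
  have hfactor : z ^ 2 + 2 * q * z + 4 * q ^ 2 - 4 =
      (z - exponentSum q) * (z + exponentSum q + 2 * q) := by linear_combination hroot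
  rw [hfactor, mul_eq_zero, or_iff_left hother, sub_eq_zero]

theorem add_ne_zero_of_norm_add_sub_two_le {k m : ℂ} (hkm : ‖k + m - 2‖ ≤ 1 / 4) : k + m ≠ 0 :=
  ne_zero_of_norm_sub_lt (w := 2) (by rw [Complex.norm_ofNat]; linarith)

theorem add_add_two_mul_ne_zero (hq : |q| < 1 / 100) {k m : ℂ} (hkm : ‖k + m - 2‖ ≤ 1 / 4) :
    k + m + 2 * q ≠ 0 := ne_zero_of_norm_sub_lt (w := 2) (by
  rw [add_sub_right_comm, Complex.norm_ofNat]
  refine (norm_add_le _ _).trans_lt ?_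
  rw [norm_mul, Complex.norm_ofNat, Complex.norm_real, Real.norm_eq_abs]
  linarith)

theorem jostA_mul_jostB_add_eq_zero_iff_quadratic (hq : |q| < 1 / 100) {k m : ℂ}
    (h : k ^ 2 + m ^ 2 = 2) (hkm : ‖k + m - 2‖ ≤ 1 / 4) :
    jostA k (Real.artanh q) * jostB m (Real.artanh q) +
      jostA m (Real.artanh q) * jostB k (Real.artanh q) = 0 ↔
      (k + m) ^ 2 + 2 * q * (k + m) + 4 * q ^ 2 - 4 = 0 := by
  rw [jostA_mul_jostB_add h, th_artanh (hq.trans (by norm_num))]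
  have hsum := add_ne_zero_of_norm_add_sub_two_le hkm
  have hshift := add_add_two_mul_ne_zero hq hkm
  have hexp := mul_ne_zero (Complex.exp_ne_zero (-(k * Real.artanh q)))
    (Complex.exp_ne_zero (-(m * Real.artanh q)))
  rw [mul_eq_zero, or_iff_left hexp, mul_eq_zero,
    or_iff_right (mul_ne_zero (div_ne_zero hsum two_ne_zero) hshift)]

theorem jostA_mul_jostB_add_eq_zero_iff (hq : |q| < 1 / 100) {l k m : ℂ}
    (hkl : k ^ 2 = 1 - 2 * l) (hml : m ^ 2 = 1 + 2 * l)
    (hk : ‖k - 1‖ ≤ 1 / 8) (hm : ‖m - 1‖ ≤ 1 / 8) :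
    jostA k (Real.artanh q) * jostB m (Real.artanh q) +
      jostA m (Real.artanh q) * jostB k (Real.artanh q) = 0 ↔ l ^ 2 = eigSq q := by
  have hsum : k ^ 2 + m ^ 2 = 2 := by linear_combination hkl + hml
  have hl : 16 * l ^ 2 = (k + m) ^ 2 * (4 - (k + m) ^ 2) := by
    have hprod : (k * m) ^ 2 = 1 - 4 * l ^ 2 := by
      rw [mul_pow, hkl, hml]
      ring
    rw [show (k + m) ^ 2 = 2 + 2 * (k * m) by linear_combination hsum]
    linear_combination 4 * hprod
  have heig : 16 * (eigSq q : ℂ) = (exponentSum q : ℂ) ^ 2 * (4 - (exponentSum q : ℂ) ^ 2) := by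
    exact_mod_cast sixteen_mul_eigSq hq
  have hkm := norm_add_sub_two_le hk hm
  rw [jostA_mul_jostB_add_eq_zero_iff_quadratic hq hsum hkm, quadratic_eq_zero_iff hq hkm]
  constructor
  · intro h
    rw [h] at hl
    linear_combination (hl - heig) / 16
  · intro h
    refine eq_of_sq_mul_four_sub_sq_eq hkm (norm_exponentSum_sub_two_le hq) ?_
    linear_combination heig - hl + 16 * h

end DispersionRelation

section OddSolution

variable {q : ℝ} {k l m o p : ℂ}

theorem OddMatching.isClassicalSolution (h : OddMatching q k m o p) (hkl : k ^ 2 = 1 - 2 * l)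
    (hml : m ^ 2 = 1 + 2 * l) (hk : 0 < k.re) (hm : 0 < m.re) :
    IsClassicalSolution q (Complex.I * l) 0 0
      (reflectExt (-1) fun x => jostCombA k m o p (x + Real.artanh q))
      (reflectExt (-(-1)) fun x => jostCombA₁ k m o p (x + Real.artanh q))
      (reflectExt (-1) fun x => Complex.I * jostCombB k m o p (x + Real.artanh q))
      (reflectExt (-(-1)) fun x => Complex.I * jostCombB₁ k m o p (x + Real.artanh q)) := by
  have hpot : ∀ c : ℂ, Continuous fun t : ℂ => 1 - c * (1 - t ^ 2) := fun c => by fun_prop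
  have dA := (expDecay_jostCombA hk hm o p).comp_add (Real.artanh q)
  have dB := (expDecay_jostCombB hk hm o p).comp_add (Real.artanh q)
  have dA₁ := (expDecay_jostCombA₁ hk hm o p).comp_add (Real.artanh q)
  have dB₁ := (expDecay_jostCombB₁ hk hm o p).comp_add (Real.artanh q)
  have hfst := inDomainC2_reflectExt (q := q) (ε := -1)
    (fun x => (hasDerivAt_jostCombA k m o p _).comp_add_const x _)
    (fun x => (hasDerivAt_jostCombA₁ hkl hml o p _).comp_add_const x _) dA dA₁
    ((dA.comp_th_add_mul (hpot 6) _).sub (dB.const_mul _))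
    (by rw [zero_add, h.fst, mul_zero]) (by rw [zero_add, h.fst]; ring)
  have hsnd := inDomainC2_reflectExt (q := q) (ε := -1)
    (fun x => ((hasDerivAt_jostCombB k m o p _).comp_add_const x _).const_mul Complex.I)
    (fun x => ((hasDerivAt_jostCombB₁ hkl hml o p _).comp_add_const x _).const_mul Complex.I)
    (dB.const_mul _) (dB₁.const_mul _)
    (((dB.comp_th_add_mul (hpot 2) _).sub (dA.const_mul _)).const_mul _)
    (by rw [zero_add, h.snd, mul_zero, mul_zero]) (by rw [zero_add, h.snd]; ring)
  constructor
  · convert hfst using 1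
    ext x
    rcases lt_or_ge x 0 with hx | hx
    · simp only [reflectExt_of_neg hx, abs_of_neg hx, Pi.zero_apply]
      linear_combination (-2) * l * jostCombB k m o p (-x + Real.artanh q) * Complex.I_sq
    · simp only [reflectExt_of_nonneg hx, abs_of_nonneg hx, Pi.zero_apply]
      linear_combination 2 * l * jostCombB k m o p (x + Real.artanh q) * Complex.I_sq
  · convert hsnd using 1
    ext x
    rcases lt_or_ge x 0 with hx | hx
    · simp only [reflectExt_of_neg hx, abs_of_neg hx, Pi.zero_apply]
      ring
    · simp only [reflectExt_of_nonneg hx, abs_of_nonneg hx, Pi.zero_apply]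
      ring

theorem oddMatching_jostB (hdet : jostA k (Real.artanh q) * jostB m (Real.artanh q) +
    jostA m (Real.artanh q) * jostB k (Real.artanh q) = 0) :
    OddMatching q k m (jostB m (Real.artanh q)) (jostB k (Real.artanh q)) where
  fst := by rw [jostCombA]; linear_combination hdet
  snd := by rw [jostCombB]; ring

theorem jostB_artanh_ne_zero (hq : |q| < 1 / 100) (hk : ‖k - 1‖ ≤ 1 / 8) :
    jostB k (Real.artanh q) ≠ 0 := by
  rw [jostB_apply, th_artanh (hq.trans (by norm_num))]
  refine mul_ne_zero (ne_zero_of_norm_sub_lt (w := 2) ?_) (Complex.exp_ne_zero _)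
  have hqn : ‖(q : ℂ)‖ ≤ 1 / 100 := by simpa using hq.le
  rw [show k ^ 2 + 1 + 2 * k * q - 2 = (k - 1) * (k - 1) + 2 * (k - 1) +
    2 * ((k - 1) * q + q) by ring, Complex.norm_ofNat]
  calc ‖(k - 1) * (k - 1) + 2 * (k - 1) + 2 * ((k - 1) * q + q)‖
      ≤ ‖k - 1‖ * ‖k - 1‖ + 2 * ‖k - 1‖ + 2 * (‖k - 1‖ * ‖(q : ℂ)‖ + ‖(q : ℂ)‖) := by
        refine (norm_add₃_le).trans ?_
        simp only [norm_mul, Complex.norm_ofNat]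
        gcongr
        exact (norm_add_le _ _).trans_eq (by rw [norm_mul])
    _ ≤ 1 / 8 * (1 / 8) + 2 * (1 / 8) + 2 * (1 / 8 * (1 / 100) + 1 / 100) := by gcongr
    _ < 2 := by norm_num

end OddSolution

section Normalization

/-- The first order operator `(∂ + tanh) / (2 l)` applied to `jostCombB k m c d`. It turns the
pairing of the two components of a solution into the integral of a square. -/
def jostCombG (k m c d : ℂ) (x : ℝ) : ℂ :=
  c * ((k + th x) * Complex.exp (-(k * x))) + d * ((m + th x) * Complex.exp (-(m * x)))

variable {q : ℝ} {k l m c d : ℂ}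

theorem jostCombB₁_add_mul (hkl : k ^ 2 = 1 - 2 * l) (hml : m ^ 2 = 1 + 2 * l) (c d : ℂ) (x : ℝ) :
    jostCombB₁ k m c d x + th x * jostCombB k m c d x = 2 * l * jostCombG k m c d x := by
  have hk := jostB₁_add_mul k x
  have hm := jostB₁_add_mul m x
  rw [hkl] at hk
  rw [hml] at hm
  rw [jostCombB₁, jostCombB, jostCombG]
  linear_combination c * hk - d * hm

theorem expDecay_jostCombG (hk : 0 < k.re) (hm : 0 < m.re) (c d : ℂ) :
    ExpDecay (jostCombG k m c d) := by
  have hadd : ∀ {k : ℂ}, 0 < k.re → ExpDecay fun x => (k + th x) * Complex.exp (-(k * x)) :=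
    fun {k} hk => by
      simpa using (expDecay_exp_neg_mul hk).comp_th_add_mul (continuous_const_add k) 0
  exact ((hadd hk).const_mul c).add ((hadd hm).const_mul d)

/-- Integrate the derivative of `B (B' + tanh B)`, where `B = jostCombB k m c d`. -/
theorem integral_jostCombA_mul_jostCombB {y : ℝ} (hkl : k ^ 2 = 1 - 2 * l)
    (hml : m ^ 2 = 1 + 2 * l) (hl : l ≠ 0) (hk : 0 < k.re) (hm : 0 < m.re)
    (hy : jostCombB k m c d y = 0) :
    ∫ x in Set.Ioi 0, jostCombA k m c d (x + y) * jostCombB k m c d (x + y) =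
      2 * l * ∫ x in Set.Ioi 0, jostCombG k m c d (x + y) ^ 2 := by
  have dA := (expDecay_jostCombA hk hm c d).comp_add y
  have dB := (expDecay_jostCombB hk hm c d).comp_add y
  have dG := (expDecay_jostCombG hk hm c d).comp_add y
  have hAB : IntegrableOn (fun x => jostCombA k m c d (x + y) * jostCombB k m c d (x + y))
      (Set.Ioi 0) := dA.memLp.integrable_mul dB.memLp
  have hG : IntegrableOn (fun x => jostCombG k m c d (x + y) ^ 2) (Set.Ioi 0) := by
    simp only [pow_two]
    exact dG.memLp.integrable_mul dG.memLp
  have hderiv : ∀ x ∈ Set.Ici (0 : ℝ), HasDerivAt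
      (fun x => jostCombB k m c d (x + y) * (2 * l * jostCombG k m c d (x + y)))
      (4 * l ^ 2 * jostCombG k m c d (x + y) ^ 2 -
        2 * l * (jostCombA k m c d (x + y) * jostCombB k m c d (x + y))) x := fun x _ => by
    simp only [← jostCombB₁_add_mul hkl hml]
    have hB := (hasDerivAt_jostCombB k m c d (x + y)).comp_add_const x y
    refine (hB.mul (((hasDerivAt_jostCombB₁ hkl hml c d (x + y)).comp_add_const x y).add
      (((hasDerivAt_th (x + y)).comp_add_const x y).mul hB))).congr_deriv ?_
    simp only [Pi.add_apply, Pi.mul_apply]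
    linear_combination (jostCombB₁ k m c d (x + y) + th (x + y) * jostCombB k m c d (x + y) +
      2 * l * jostCombG k m c d (x + y)) * jostCombB₁_add_mul hkl hml c d (x + y)
  have hlim : Tendsto (fun x => jostCombB k m c d (x + y) * (2 * l * jostCombG k m c d (x + y)))
      atTop (𝓝 0) := by
    simpa using dB.tendsto_atTop.mul (dG.tendsto_atTop.const_mul (2 * l))
  have hint := integral_Ioi_of_hasDerivAt_of_tendsto' hderiv
    ((hG.const_mul _).sub (hAB.const_mul _)) hlim
  rw [zero_add, hy, zero_mul, sub_zero, integral_sub (hG.const_mul _) (hAB.const_mul _),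
    integral_const_mul, integral_const_mul] at hint
  refine mul_left_cancel₀ (mul_ne_zero two_ne_zero hl) ?_
  linear_combination -hint

theorem jostCombG_artanh_ne_zero (hq : |q| < 1 / 100) (hk : ‖k - 1‖ ≤ 1 / 8)
    (hm : ‖m - 1‖ ≤ 1 / 8) (h : k ^ 2 + m ^ 2 = 2) :
    jostCombG k m (jostB m (Real.artanh q)) (jostB k (Real.artanh q)) (Real.artanh q) ≠ 0 := by
  have hfactor : jostCombG k m (jostB m (Real.artanh q)) (jostB k (Real.artanh q))
      (Real.artanh q) = (k + m) / 2 * (k + m + 2 * q) ^ 2 *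
        (Complex.exp (-(k * Real.artanh q)) * Complex.exp (-(m * Real.artanh q))) := by
    rw [jostCombG, jostB_apply, jostB_apply, th_artanh (hq.trans (by norm_num))]
    linear_combination (-((k + m) / 2 + q)) *
      (Complex.exp (-(k * Real.artanh q)) * Complex.exp (-(m * Real.artanh q))) * h
  have hkm := norm_add_sub_two_le hk hm
  rw [hfactor]
  exact mul_ne_zero (mul_ne_zero (div_ne_zero (add_ne_zero_of_norm_add_sub_two_le hkm)
    two_ne_zero) (pow_ne_zero 2 (add_add_two_mul_ne_zero hq hkm)))
    (mul_ne_zero (Complex.exp_ne_zero _) (Complex.exp_ne_zero _))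

open ComplexConjugate

theorem conj_th (y : ℝ) : conj (th y) = th y := Complex.conj_ofReal _

theorem conj_jostB (k : ℂ) (y : ℝ) : conj (jostB k y) = jostB (conj k) y := by
  simp [jostB_apply, conj_th, map_ofNat, ← Complex.exp_conj]

theorem conj_jostCombG (k m c d : ℂ) (x : ℝ) :
    conj (jostCombG k m c d x) = jostCombG (conj k) (conj m) (conj c) (conj d) x := by
  simp [jostCombG, conj_th, ← Complex.exp_conj]

theorem conj_eq_of_conj_sq_eq {z w : ℂ} (hz : 0 < z.re) (hw : 0 < w.re)
    (h : conj (z ^ 2) = w ^ 2) : conj z = w := by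
  rw [map_pow] at h
  refine (sq_eq_sq_iff_eq_or_eq_neg.1 h).resolve_right fun hneg => ?_
  have hre := congrArg Complex.re hneg
  rw [Complex.conj_re, Complex.neg_re] at hre
  linarith

/-- If `l` is real the exponents are real, and if `l` is imaginary they are conjugate. -/
theorem conj_exponents {s : ℝ} (hl : l ^ 2 = s) (hkl : k ^ 2 = 1 - 2 * l)
    (hml : m ^ 2 = 1 + 2 * l) (hk : 0 < k.re) (hm : 0 < m.re) :
    (conj k = k ∧ conj m = m) ∨ (conj k = m ∧ conj m = k) := by
  have hconj : conj l ^ 2 = l ^ 2 := by rw [← map_pow, hl, Complex.conj_ofReal]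
  rcases sq_eq_sq_iff_eq_or_eq_neg.1 hconj with h | h
  · exact Or.inl ⟨conj_eq_of_conj_sq_eq hk hk (by simp [hkl, h, map_ofNat]),
      conj_eq_of_conj_sq_eq hm hm (by simp [hml, h, map_ofNat])⟩
  · exact Or.inr ⟨conj_eq_of_conj_sq_eq hk hm (by simp [hkl, hml, h, map_ofNat]),
      conj_eq_of_conj_sq_eq hm hk (by simp [hkl, hml, h, map_ofNat, sub_eq_add_neg])⟩

theorem conj_jostCombG_jostB {s : ℝ} (hl : l ^ 2 = s) (hkl : k ^ 2 = 1 - 2 * l)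
    (hml : m ^ 2 = 1 + 2 * l) (hk : 0 < k.re) (hm : 0 < m.re) (y x : ℝ) :
    conj (jostCombG k m (jostB m y) (jostB k y) x) =
      jostCombG k m (jostB m y) (jostB k y) x := by
  rw [conj_jostCombG, conj_jostB, conj_jostB]
  rcases conj_exponents hl hkl hml hk hm with ⟨hk', hm'⟩ | ⟨hk', hm'⟩
  · rw [hk', hm']
  · rw [hk', hm', jostCombG, jostCombG, add_comm]

theorem integral_Ioi_sq_ne_zero {G : ℝ → ℂ} (hG : ExpDecay G) (hconj : ∀ x, conj (G x) = G x)
    (h0 : G 0 ≠ 0) : ∫ x in Set.Ioi 0, G x ^ 2 ≠ 0 := by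
  have hre : ∀ x, ((G x).re : ℂ) = G x := fun x => Complex.conj_eq_iff_re.1 (hconj x)
  have hsq : ∀ x, G x ^ 2 = (((G x).re ^ 2 : ℝ) : ℂ) := fun x => by rw [Complex.ofReal_pow, hre]
  have hint : IntegrableOn (fun x => (G x).re ^ 2) (Set.Ioi 0) :=
    (hG.memLp.re.integrable_sq : Integrable _ _)
  have hopen : IsOpen (Function.support fun x => (G x).re ^ 2) :=
    ((Complex.continuous_re.comp hG.continuous).pow 2).isOpen_support
  have hmem : (0 : ℝ) ∈ Function.support fun x => (G x).re ^ 2 :=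
    pow_ne_zero 2 fun h => h0 (by rw [← hre, h, Complex.ofReal_zero])
  have hpos : 0 < ∫ x in Set.Ioi 0, (G x).re ^ 2 := by
    rw [setIntegral_pos_iff_support_of_nonneg_ae
      (Eventually.of_forall fun x => sq_nonneg _) hint]
    refine (hopen.inter isOpen_Ioi).measure_pos volume ?_
    exact mem_closure_iff.1 (by rw [closure_Ioi]; exact Set.self_mem_Ici) _ hopen hmem
  simp_rw [hsq]
  rw [integral_complex_ofReal, Complex.ofReal_ne_zero]
  exact hpos.ne'

theorem integral_reflectExt_mul_reflectExt {ε : ℂ} (hε : ε ^ 2 = 1) {A B : ℝ → ℂ}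
    (hAB : IntegrableOn (fun x => A x * B x) (Set.Ioi 0)) :
    ∫ x, reflectExt ε A x * reflectExt ε B x = 2 * ∫ x in Set.Ioi 0, A x * B x := by
  have hpos : Set.EqOn (fun x => A x * B x) (fun x => reflectExt ε A x * reflectExt ε B x)
      (Set.Ioi 0) := fun x hx => by
    simp only [reflectExt_of_nonneg (Set.mem_Ioi.1 hx).le]
  have hneg : Set.EqOn (fun x => A (-x) * B (-x))
      (fun x => reflectExt ε A x * reflectExt ε B x) (Set.Iio 0) := fun x hx => by
    simp only [reflectExt_of_neg hx]
    linear_combination -(A (-x) * B (-x)) * hε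
  have hAB' : IntegrableOn (fun x => A (-x) * B (-x)) (Set.Iio 0) := by
    simpa using hAB.comp_neg
  rw [← intervalIntegral.integral_Iic_add_Ioi ((hAB'.congr_fun hneg measurableSet_Iio).congr_set_ae
      Iio_ae_eq_Iic.symm) (hAB.congr_fun hpos measurableSet_Ioi),
    ← setIntegral_congr_fun measurableSet_Ioi hpos, integral_Iic_eq_integral_Iio,
    ← setIntegral_congr_fun measurableSet_Iio hneg, ← integral_Iic_eq_integral_Iio,
    integral_comp_neg_Iic 0 fun x => A x * B x, neg_zero, two_mul]

theorem integral_odd_jostComb_ne_zero (hq : |q| < 1 / 100) {s : ℝ} (hs : l ^ 2 = s) (hl : l ≠ 0)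
    (hkl : k ^ 2 = 1 - 2 * l) (hml : m ^ 2 = 1 + 2 * l)
    (hk : ‖k - 1‖ ≤ 1 / 8) (hm : ‖m - 1‖ ≤ 1 / 8) {o p : ℂ} (ho : o = jostB m (Real.artanh q))
    (hp : p = jostB k (Real.artanh q)) :
    ∫ x, reflectExt (-1) (fun x => jostCombA k m o p (x + Real.artanh q)) x *
      reflectExt (-1) (fun x => Complex.I * jostCombB k m o p (x + Real.artanh q)) x ≠ 0 := by
  subst ho hp
  have hkre := re_pos_of_norm_sub_one_lt (k := k) (by linarith)
  have hmre := re_pos_of_norm_sub_one_lt (k := m) (by linarith)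
  have dA := (expDecay_jostCombA hkre hmre (jostB m (Real.artanh q))
    (jostB k (Real.artanh q))).comp_add (Real.artanh q)
  have dB := (expDecay_jostCombB hkre hmre (jostB m (Real.artanh q))
    (jostB k (Real.artanh q))).comp_add (Real.artanh q)
  have dG := (expDecay_jostCombG hkre hmre (jostB m (Real.artanh q))
    (jostB k (Real.artanh q))).comp_add (Real.artanh q)
  rw [integral_reflectExt_mul_reflectExt (by ring)
    (dA.memLp.integrable_mul (dB.const_mul Complex.I).memLp)]
  simp only [mul_left_comm _ Complex.I]
  rw [integral_const_mul, integral_jostCombA_mul_jostCombB hkl hml hl hkre hmre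
    (by rw [jostCombB]; ring)]
  refine mul_ne_zero two_ne_zero (mul_ne_zero Complex.I_ne_zero
    (mul_ne_zero (mul_ne_zero two_ne_zero hl) (integral_Ioi_sq_ne_zero dG
      (fun x => conj_jostCombG_jostB hs hkl hml hkre hmre _ _) ?_)))
  rw [zero_add]
  exact jostCombG_artanh_ne_zero hq hk hm (by linear_combination hkl + hml)

end Normalization

section GeneralizedEigenspace

variable {E : Type*} [AddCommGroup E] [Module ℂ E] {T : E →ₗ.[ℂ] E} {z : ℂ} {u v w : E}

theorem genEigenspace_le {S : Submodule ℂ E}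
    (h : ∀ (u : E) (hu : u ∈ T.domain), T ⟨u, hu⟩ - z • u ∈ S → u ∈ S) :
    genEigenspace T z ≤ S := by
  refine iSup_le fun n => ?_
  induction n with
  | zero => exact bot_le
  | succ n ih =>
    intro u hu
    obtain ⟨hd, hu⟩ := (mem_kerPow_succ T z n u).1 hu
    exact h u hd (ih hu)

theorem mem_genEigenspace_of_eq_smul_add (hv : v ∈ genEigenspace T z)
    (hu : ∃ h : u ∈ T.domain, T ⟨u, h⟩ = z • u + v) : u ∈ genEigenspace T z := by
  have hmono : Monotone (kerPow T z) := monotone_nat_of_le_succ fun n => by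
    induction n with
    | zero => exact bot_le
    | succ n ih =>
      intro u hu
      obtain ⟨hd, hu⟩ := (mem_kerPow_succ T z n u).1 hu
      exact (mem_kerPow_succ T z (n + 1) u).2 ⟨hd, ih hu⟩
  obtain ⟨n, hn⟩ := (Submodule.mem_iSup_of_directed _ hmono.directed_le).1 hv
  obtain ⟨hd, h⟩ := hu
  exact (le_iSup (kerPow T z) (n + 1))
    ((mem_kerPow_succ T z n u).2 ⟨hd, by rwa [h, add_sub_cancel_left]⟩)

theorem mem_genEigenspace_of_eq_smul (hu : ∃ h : u ∈ T.domain, T ⟨u, h⟩ = z • u) :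
    u ∈ genEigenspace T z :=
  mem_genEigenspace_of_eq_smul_add (zero_mem _) (by simpa only [add_zero] using hu)

theorem exists_sub_smul_eq {r : E} (c : ℂ) (hu : ∃ h : u ∈ T.domain, T ⟨u, h⟩ = z • u + (c • v + r))
    (hw : ∃ h : w ∈ T.domain, T ⟨w, h⟩ = z • w + v) :
    ∃ h : u - c • w ∈ T.domain, T ⟨u - c • w, h⟩ = z • (u - c • w) + r := by
  obtain ⟨hu, hTu⟩ := hu
  obtain ⟨hw, hTw⟩ := hw
  refine ⟨T.domain.sub_mem hu (T.domain.smul_mem c hw), ?_⟩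
  have hmap := T.map_sub ⟨u, hu⟩ (c • ⟨w, hw⟩)
  rw [T.map_smul, hTu, hTw] at hmap
  refine hmap.trans ?_
  module

theorem genEigenspace_eq_span_singleton (hw : ∃ h : w ∈ T.domain, T ⟨w, h⟩ = z • w)
    (hker : ∀ u, (∃ h : u ∈ T.domain, T ⟨u, h⟩ = z • u) → u ∈ Submodule.span ℂ {w})
    (hrange : ∀ u (c : ℂ), (∃ h : u ∈ T.domain, T ⟨u, h⟩ = z • u + c • w) → c = 0) :
    genEigenspace T z = Submodule.span ℂ {w} := by
  refine le_antisymm (genEigenspace_le fun u hu hmem => ?_)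
    ((Submodule.span_singleton_le_iff_mem _ _).2 (mem_genEigenspace_of_eq_smul hw))
  obtain ⟨c, hc⟩ := Submodule.mem_span_singleton.1 hmem
  have hTu : T ⟨u, hu⟩ = z • u + c • w := by rw [hc, add_sub_cancel]
  refine hker u ⟨hu, ?_⟩
  rw [hTu, hrange u c ⟨hu, hTu⟩, zero_smul, add_zero]

theorem genEigenspace_eq_span_pair (hv : ∃ h : v ∈ T.domain, T ⟨v, h⟩ = z • v)
    (hw : ∃ h : w ∈ T.domain, T ⟨w, h⟩ = z • w + v)
    (hker : ∀ u, (∃ h : u ∈ T.domain, T ⟨u, h⟩ = z • u) → u ∈ Submodule.span ℂ {v})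
    (hrange : ∀ u (c : ℂ), (∃ h : u ∈ T.domain, T ⟨u, h⟩ = z • u + c • w) → c = 0) :
    genEigenspace T z = Submodule.span ℂ {v, w} := by
  have hvmem := mem_genEigenspace_of_eq_smul hv
  refine le_antisymm (genEigenspace_le fun u hu hmem => ?_) (Submodule.span_le.2 ?_)
  · obtain ⟨a, c, hac⟩ := Submodule.mem_span_pair.1 hmem
    have hsub := exists_sub_smul_eq a ⟨hu, by rw [hac, add_sub_cancel]⟩ hw
    have hc := hrange _ c hsub
    rw [hc, zero_smul, add_zero] at hsub
    obtain ⟨b, hb⟩ := Submodule.mem_span_singleton.1 (hker _ hsub)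
    exact Submodule.mem_span_pair.2 ⟨b, a, by rw [hb, sub_add_cancel]⟩
  · rintro x (rfl | rfl)
    · exact hvmem
    · exact mem_genEigenspace_of_eq_smul_add hvmem hw

end GeneralizedEigenspace

section SimpleEigenvalue

variable {q : ℝ} {l k m : ℂ}

theorem coeFn_smul_ae_eq (c : ℂ) {a : L2} {f : ℝ → ℂ} (ha : a =ᵐ[volume] f) :
    ⇑(c • a) =ᵐ[volume] fun x => c * f x :=
  (Lp.coeFn_smul c a).trans (ha.const_smul c)

theorem eq_smul_of_ae_eq {a b : L2} {c : ℂ} {f : ℝ → ℂ}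
    (ha : a =ᵐ[volume] fun x => c * f x) (hb : b =ᵐ[volume] f) : a = c • b :=
  Lp.ext (ha.trans (coeFn_smul_ae_eq c hb).symm)

theorem ne_zero_of_integral_mul_ne_zero {a : L2} {f g : ℝ → ℂ} (ha : a =ᵐ[volume] f)
    (hfg : ∫ x, f x * g x ≠ 0) : a ≠ 0 := by
  rintro rfl
  refine hfg (integral_eq_zero_of_ae ?_)
  filter_upwards [ha, Lp.coeFn_zero ℂ 2 (volume : Measure ℝ)] with x hx h0
  rw [← hx, h0, Pi.zero_apply, zero_mul]

theorem exists_isClassicalSolution_of_eq_smul {z : ℂ} {u : L2 × L2}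
    (hu : ∃ h : u ∈ (F q).domain, F q ⟨u, h⟩ = z • u) :
    ∃ f f₁ g g₁, u.1 =ᵐ[volume] f ∧ u.2 =ᵐ[volume] g ∧ IsClassicalSolution q z 0 0 f f₁ g g₁ :=
  exists_isClassicalSolution (r := 0) (by simpa only [add_zero] using hu)
    (Lp.coeFn_zero _ _ _) (Lp.coeFn_zero _ _ _) (fun _ _ => continuousAt_const)
    fun _ _ => continuousAt_const

theorem IsClassicalSolution.exists_F_eq_smul {z : ℂ} {u : L2 × L2} {f f₁ g g₁ : ℝ → ℂ}
    (h : IsClassicalSolution q z 0 0 f f₁ g g₁) (huf : u.1 =ᵐ[volume] f)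
    (hug : u.2 =ᵐ[volume] g) : ∃ h : u ∈ (F q).domain, F q ⟨u, h⟩ = z • u := by
  simpa only [add_zero] using
    h.exists_F_eq (r := 0) huf hug (Lp.coeFn_zero _ _ _) (Lp.coeFn_zero _ _ _)

theorem IsClassicalSolution.eq_zero_of_exists_F_eq {z c : ℂ} {u r : L2 × L2}
    {a a₁ b b₁ ρ₁ ρ₂ : ℝ → ℂ} (H : IsClassicalSolution q z 0 0 a a₁ b b₁)
    (hρ₁ : r.1 =ᵐ[volume] ρ₁) (hρ₂ : r.2 =ᵐ[volume] ρ₂) (hρ₁c : Continuous ρ₁)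
    (hρ₂c : Continuous ρ₂) (hne : ∫ x, (ρ₁ x * b x + ρ₂ x * a x) ≠ 0)
    (hu : ∃ h : u ∈ (F q).domain, F q ⟨u, h⟩ = z • u + c • r) : c = 0 := by
  obtain ⟨f, f₁, g, g₁, -, -, h⟩ := exists_isClassicalSolution hu
    (coeFn_smul_ae_eq c hρ₁) (coeFn_smul_ae_eq c hρ₂)
    (fun x _ => (hρ₁c.const_mul c).continuousAt) fun x _ => (hρ₂c.const_mul c).continuousAt
  have hzero := h.integral_mul_add_mul_eq_zero H
  simp only [mul_assoc c, ← mul_add, integral_const_mul] at hzero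
  exact (mul_eq_zero.1 hzero).resolve_right hne

theorem add_ofReal_ne_zero (hq : |q| < 1 / 100) (hk : ‖k - 1‖ ≤ 1 / 8) : k + q ≠ 0 :=
  ne_zero_of_norm_sub_lt (w := 1) (by
    rw [add_sub_right_comm, norm_one]
    refine (norm_add_le _ _).trans_lt ?_
    rw [Complex.norm_real, Real.norm_eq_abs]
    linarith)

/-- Since `tanh (artanh q) = q`, the even matching conditions only involve
`(∂ + tanh) jostA` and `(∂ + tanh) jostB`, which factor. -/
theorem EvenMatching.eq_zero {e d : ℂ} (h : EvenMatching q k m e d) (hq : |q| < 1 / 100)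
    (hl : l ≠ 0) (hkl : k ^ 2 = 1 - 2 * l) (hml : m ^ 2 = 1 + 2 * l)
    (hk : ‖k - 1‖ ≤ 1 / 8) (hm : ‖m - 1‖ ≤ 1 / 8) : e = 0 ∧ d = 0 := by
  have hA := fun k => jostA₁_add_mul k (Real.artanh q)
  have hB := fun k => jostB₁_add_mul k (Real.artanh q)
  simp only [th_artanh (hq.trans (by norm_num : (1 / 100 : ℝ) < 1))] at hA hB
  obtain ⟨hfst, hsnd⟩ := h
  rw [jostCombA₁, jostCombA] at hfst
  rw [jostCombB₁, jostCombB] at hsnd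
  have hne : ∀ k : ℂ, ‖k - 1‖ ≤ 1 / 8 → (k + q) * Complex.exp (-(k * Real.artanh q)) ≠ 0 :=
    fun k hk => mul_ne_zero (add_ofReal_ne_zero hq hk) (Complex.exp_ne_zero _)
  set X := e * ((k + q) * Complex.exp (-(k * Real.artanh q))) with hX
  set Y := d * ((m + q) * Complex.exp (-(m * Real.artanh q))) with hY
  have hadd : X + Y = 0 := by
    refine mul_left_cancel₀ (mul_ne_zero two_ne_zero hl) ?_
    have hBk := hB k
    have hBm := hB m
    rw [hkl] at hBk
    rw [hml] at hBm
    rw [hX, hY]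
    linear_combination hsnd - e * hBk + d * hBm
  have hsub : X - Y = 0 := by
    refine mul_left_cancel₀ (mul_ne_zero two_ne_zero hl) ?_
    have hAk := hA k
    have hAm := hA m
    rw [hkl] at hAk
    rw [hml] at hAm
    rw [hX, hY] at *
    linear_combination hfst - e * hAk - d * hAm - (2 - 2 * (q : ℂ) ^ 2) * hadd
  have hX0 : X = 0 := by linear_combination (hadd + hsub) / 2
  have hY0 : Y = 0 := by linear_combination (hadd - hsub) / 2
  exact ⟨(mul_eq_zero.1 hX0).resolve_right (hne k hk),
    (mul_eq_zero.1 hY0).resolve_right (hne m hm)⟩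

theorem OddMatching.eq_zero {o p : ℂ} (h : OddMatching q k m o p)
    (hdet : jostA k (Real.artanh q) * jostB m (Real.artanh q) +
      jostA m (Real.artanh q) * jostB k (Real.artanh q) ≠ 0) : o = 0 ∧ p = 0 := by
  obtain ⟨hfst, hsnd⟩ := h
  rw [jostCombA] at hfst
  rw [jostCombB] at hsnd
  constructor <;> refine mul_right_cancel₀ hdet ?_
  · linear_combination jostB m (Real.artanh q) * hfst + jostA m (Real.artanh q) * hsnd
  · linear_combination jostB k (Real.artanh q) * hfst - jostA k (Real.artanh q) * hsnd

theorem OddMatching.exists_eq_mul {o p : ℂ} (h : OddMatching q k m o p)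
    (hB : jostB m (Real.artanh q) ≠ 0) :
    ∃ t : ℂ, o = t * jostB m (Real.artanh q) ∧ p = t * jostB k (Real.artanh q) := by
  refine ⟨o / jostB m (Real.artanh q), (div_mul_cancel₀ _ hB).symm, ?_⟩
  rw [div_mul_eq_mul_div, eq_div_iff hB]
  have hsnd := h.snd
  rw [jostCombB] at hsnd
  linear_combination -hsnd

theorem reflectExt_zero (ε : ℂ) : reflectExt ε (fun _ => 0) = 0 := by
  ext x
  simp [reflectExt]

theorem reflectExt_const_mul (ε c : ℂ) (A : ℝ → ℂ) :
    reflectExt ε (fun x => c * A x) = fun x => c * reflectExt ε A x := by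
  ext x
  simp only [reflectExt]
  split_ifs <;> ring

theorem reflectExt_neg_one_comp_neg {A : ℝ → ℂ} (h0 : A 0 = 0) (x : ℝ) :
    reflectExt (-1) A (-x) = -reflectExt (-1) A x := by
  rcases lt_trichotomy x 0 with hx | rfl | hx
  · rw [reflectExt_of_neg hx, reflectExt_of_nonneg (neg_nonneg.2 hx.le)]
    ring
  · rw [neg_zero, reflectExt_of_nonneg le_rfl, h0, neg_zero]
  · rw [reflectExt_of_nonneg hx.le, reflectExt_of_neg (neg_neg_of_pos hx), neg_neg]
    ring

theorem eq_zero_of_F_eq_smul (hq : |q| < 1 / 100) (hl : l ≠ 0) (hln : ‖l‖ ≤ 1 / 16)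
    (hs : l ^ 2 ≠ eigSq q) {u : L2 × L2}
    (hu : ∃ h : u ∈ (F q).domain, F q ⟨u, h⟩ = (Complex.I * l) • u) : u = 0 := by
  obtain ⟨k, m, hkl, hml, hk, hm⟩ := exists_exponents hln
  obtain ⟨f, f₁, g, g₁, huf, hug, h⟩ := exists_isClassicalSolution_of_eq_smul hu
  obtain ⟨e, d, o, p, heven, hodd, hfg⟩ := h.exists_matching hkl hml hk hm (hq.trans (by norm_num))
  obtain ⟨rfl, rfl⟩ := heven.eq_zero hq hl hkl hml hk hm
  obtain ⟨rfl, rfl⟩ := hodd.eq_zero (mt (jostA_mul_jostB_add_eq_zero_iff hq hkl hml hk hm).1 hs)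
  simp only [jostCombA, jostCombB, zero_mul, add_zero, sub_zero, reflectExt_zero, Pi.zero_apply,
    mul_zero] at hfg
  exact Prod.ext (Lp.ext (huf.trans ((EventuallyEq.of_eq (funext fun x => (hfg x).1)).trans
    (Lp.coeFn_zero _ _ _).symm))) (Lp.ext (hug.trans
    ((EventuallyEq.of_eq (funext fun x => (hfg x).2)).trans (Lp.coeFn_zero _ _ _).symm)))

theorem exists_odd_isClassicalSolution (hq : |q| < 1 / 100) (hl : l ≠ 0) (hln : ‖l‖ ≤ 1 / 16)
    (hs : l ^ 2 = eigSq q) : ∃ a a₁ b b₁, IsClassicalSolution q (Complex.I * l) 0 0 a a₁ b b₁ ∧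
      (∀ x, a (-x) = -a x) ∧ (∀ x, b (-x) = -b x) ∧ ∫ x, a x * b x ≠ 0 ∧
      ∀ {f f₁ g g₁ : ℝ → ℂ}, IsClassicalSolution q (Complex.I * l) 0 0 f f₁ g g₁ →
        ∃ t : ℂ, (f = fun x => t * a x) ∧ g = fun x => t * b x := by
  obtain ⟨k, m, hkl, hml, hk, hm⟩ := exists_exponents hln
  have hodd := oddMatching_jostB ((jostA_mul_jostB_add_eq_zero_iff hq hkl hml hk hm).2 hs)
  refine ⟨_, _, _, _, hodd.isClassicalSolution hkl hml (re_pos_of_norm_sub_one_lt (by linarith))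
    (re_pos_of_norm_sub_one_lt (by linarith)),
    reflectExt_neg_one_comp_neg (by rw [zero_add, hodd.fst]),
    reflectExt_neg_one_comp_neg (by rw [zero_add, hodd.snd, mul_zero]),
    integral_odd_jostComb_ne_zero hq hs hl hkl hml hk hm rfl rfl, fun {f f₁ g g₁} h => ?_⟩
  obtain ⟨e, d, o, p, heven, hodd', hfg⟩ := h.exists_matching hkl hml hk hm (hq.trans (by norm_num))
  obtain ⟨rfl, rfl⟩ := heven.eq_zero hq hl hkl hml hk hm
  obtain ⟨t, rfl, rfl⟩ := hodd'.exists_eq_mul (jostB_artanh_ne_zero hq hm)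
  simp only [jostCombA, jostCombB, zero_mul, add_zero, sub_zero, reflectExt_zero, Pi.zero_apply,
    zero_add, mul_assoc t, ← mul_add, ← mul_sub, reflectExt_const_mul] at hfg
  refine ⟨t, funext fun x => ?_, funext fun x => ?_⟩
  · simpa only [jostCombA] using (hfg x).1
  · simpa only [jostCombB, reflectExt_const_mul, mul_left_comm t] using (hfg x).2

theorem isOdd_of_ae_eq {u : L2 × L2} {f g : ℝ → ℂ} (huf : u.1 =ᵐ[volume] f)
    (hug : u.2 =ᵐ[volume] g) (hf : ∀ x, f (-x) = -f x) (hg : ∀ x, g (-x) = -g x) : IsOdd u := by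
  have hneg := (Measure.measurePreserving_neg (volume : Measure ℝ)).quasiMeasurePreserving
  filter_upwards [huf, hug, hneg.ae huf, hneg.ae hug] with x hfx hgx hfx' hgx'
  rw [hfx, hgx, hfx', hgx', hf, hg]
  exact ⟨rfl, rfl⟩

theorem exists_odd_eigenvector (hq : |q| < 1 / 100) (hl : l ≠ 0) (hln : ‖l‖ ≤ 1 / 16)
    (hs : l ^ 2 = eigSq q) : ∃ w : L2 × L2, w ≠ 0 ∧ IsOdd w ∧
      (∃ h : w ∈ (F q).domain, F q ⟨w, h⟩ = (Complex.I * l) • w) ∧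
      genEigenspace (F q) (Complex.I * l) = Submodule.span ℂ {w} := by
  obtain ⟨a, a₁, b, b₁, H, ha, hb, hab, hker⟩ := exists_odd_isClassicalSolution hq hl hln hs
  obtain ⟨w, hwa, hwb⟩ : ∃ w : L2 × L2, w.1 =ᵐ[volume] a ∧ w.2 =ᵐ[volume] b :=
    ⟨(H.fst.memLp.toLp a, H.snd.memLp.toLp b), H.fst.memLp.coeFn_toLp, H.snd.memLp.coeFn_toLp⟩
  have hw := H.exists_F_eq_smul hwa hwb
  refine ⟨w, ?_, isOdd_of_ae_eq hwa hwb ha hb, hw, genEigenspace_eq_span_singleton hw ?_ ?_⟩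
  · rintro rfl
    exact ne_zero_of_integral_mul_ne_zero hwa hab rfl
  · intro u hu
    obtain ⟨f, f₁, g, g₁, huf, hug, h⟩ := exists_isClassicalSolution_of_eq_smul hu
    obtain ⟨t, rfl, rfl⟩ := hker h
    exact Submodule.mem_span_singleton.2
      ⟨t, (Prod.ext (eq_smul_of_ae_eq huf hwa) (eq_smul_of_ae_eq hug hwb)).symm⟩
  · refine fun u c => H.eq_zero_of_exists_F_eq hwa hwb H.fst.continuous H.snd.continuous ?_
    simpa only [mul_comm (b _), ← two_mul, integral_const_mul] using mul_ne_zero two_ne_zero hab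

end SimpleEigenvalue

section Symmetry

variable {q : ℝ} {z : ℂ} {w : L2 × L2}

theorem exists_F_sigma3_eq (h : ∃ h : w ∈ (F q).domain, F q ⟨w, h⟩ = z • w) :
    ∃ h : sigma3 w ∈ (F q).domain, F q ⟨sigma3 w, h⟩ = (-z) • sigma3 w := by
  obtain ⟨hplus, hminus⟩ := exists_F_eq_iff.1 h
  refine exists_F_eq_iff.2 ⟨?_, ?_⟩
  · simpa [sigma3] using hplus
  · simpa [sigma3] using neg_mem hminus

theorem IsOdd.sigma3 (h : IsOdd w) : IsOdd (sigma3 w) := by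
  have hneg := (Measure.measurePreserving_neg (volume : Measure ℝ)).quasiMeasurePreserving
  filter_upwards [h, Lp.coeFn_neg w.2, hneg.ae (Lp.coeFn_neg w.2)] with x hx hcoe hcoe'
  refine ⟨hx.1, ?_⟩
  change (-w.2 : L2) (-x) = -(-w.2 : L2) x
  rw [hcoe, hcoe', Pi.neg_apply, Pi.neg_apply, hx.2]

theorem sigma3_sigma3 (w : L2 × L2) : sigma3 (sigma3 w) = w := by
  simp [sigma3]

end Symmetry

section DilationMode

theorem tendsto_th_atTop : Tendsto th atTop (𝓝 1) := by
  have hsech := expDecay_sech.tendsto_atTop.mul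
    (expDecay_exp_neg_mul (k := 1) (by norm_num)).tendsto_atTop
  have hsub := hsech.const_sub 1
  rw [mul_zero, sub_zero] at hsub
  refine hsub.congr fun y => ?_
  have hcosh := (Real.cosh_pos y).ne'
  have htanh : 1 - (Real.cosh y)⁻¹ * Real.exp (-y) = Real.tanh y := by
    rw [Real.tanh_eq_sinh_div_cosh, ← Real.cosh_sub_sinh]
    field_simp
    ring
  rw [th, ← htanh, sech]
  push_cast
  ring_nf

theorem hasDerivAt_artanh {x : ℝ} (hx : x ∈ Set.Ioo (-1 : ℝ) 1) :
    HasDerivAt Real.artanh (1 / (1 - x ^ 2)) x := by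
  have hadd : 0 < 1 + x := by linarith [hx.1]
  have hsub : 0 < 1 - x := by linarith [hx.2]
  have hlog : HasDerivAt (fun x : ℝ => 1 / 2 * (Real.log (1 + x) - Real.log (1 - x)))
      (1 / 2 * (1 / (1 + x) - -1 / (1 - x))) x :=
    ((((hasDerivAt_id x).const_add 1).log hadd.ne').sub
      (((hasDerivAt_id x).const_sub 1).log hsub.ne')).const_mul _
  refine (hlog.congr_of_eventuallyEq ?_).congr_deriv ?_
  · filter_upwards [Ioo_mem_nhds hx.1 hx.2] with y hy
    rw [Real.artanh_eq_half_log ⟨hy.1.le, hy.2.le⟩,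
      Real.log_div (by linarith [hy.1]) (by linarith [hy.2])]
  · have hsq : 1 - x ^ 2 ≠ 0 := by nlinarith
    field_simp
    ring

/-- The derivative `∂_λ v_λ` at `λ = 1` as a function of `y = |x| + artanh q`. The parameter is
`s = artanh q + q / (1 - q²)`, so that `y - s` is the derivative of `λ |x| + artanh (q / λ)`. -/
def dilationMode (s y : ℝ) : ℂ := sech y - (y - s) * (th y * sech y)

/-- The derivative of `dilationMode s`. -/
def dilationMode₁ (s y : ℝ) : ℂ :=
  -2 * (th y * sech y) - (y - s) * (sech y * (1 - 2 * th y ^ 2))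

variable {q : ℝ} (s y : ℝ)

theorem hasDerivAt_th_mul_sech :
    HasDerivAt (fun y => th y * sech y) (sech y * (1 - 2 * th y ^ 2)) y :=
  ((hasDerivAt_th y).mul (hasDerivAt_sech y)).congr_deriv (by ring)

theorem hasDerivAt_ofReal_sub_const : HasDerivAt (fun y : ℝ => (y : ℂ) - s) 1 y :=
  (hasDerivAt_id y).ofReal_comp.sub_const (s : ℂ)

theorem hasDerivAt_dilationMode : HasDerivAt (dilationMode s) (dilationMode₁ s y) y := by
  refine ((hasDerivAt_sech y).sub
    ((hasDerivAt_ofReal_sub_const s y).mul (hasDerivAt_th_mul_sech y))).congr_deriv ?_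
  rw [dilationMode₁]
  ring

theorem hasDerivAt_dilationMode₁ : HasDerivAt (dilationMode₁ s)
    ((1 - 6 * (1 - th y ^ 2)) * dilationMode s y + 2 * sech y) y := by
  refine (((hasDerivAt_th_mul_sech y).const_mul (-2)).sub
    ((hasDerivAt_ofReal_sub_const s y).mul ((hasDerivAt_sech y).mul
    ((((hasDerivAt_th y).pow 2).const_mul 2).const_sub 1)))).congr_deriv ?_
  simp only [Pi.pow_apply, Pi.mul_apply, dilationMode]
  push_cast
  ring

theorem expDecay_th_mul_sech : ExpDecay fun y => th y * sech y := by
  simpa using expDecay_sech.comp_th_add_mul continuous_id 0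

theorem expDecay_dilationMode : ExpDecay (dilationMode s) := by
  have h := (expDecay_sech.sub expDecay_th_mul_sech.ofReal_mul).add
    (expDecay_th_mul_sech.const_mul s)
  convert h using 2 with y
  rw [dilationMode]
  ring

theorem expDecay_dilationMode₁ : ExpDecay (dilationMode₁ s) := by
  have hquad : ExpDecay fun y => (1 - 2 * th y ^ 2) * sech y := by
    simpa using expDecay_sech.comp_th_add_mul (P := fun t => 1 - 2 * t ^ 2) (by fun_prop) 0
  have h := ((expDecay_th_mul_sech.const_mul (-2)).sub hquad.ofReal_mul).add (hquad.const_mul s)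
  convert h using 2 with y
  rw [dilationMode₁]
  ring

theorem hasDerivAt_groundState (hq : |q| < 1) (x : ℝ) :
    HasDerivAt (fun l => groundState q l x)
      ((Real.cosh (|x| + Real.artanh q))⁻¹ - (|x| - q / (1 - q ^ 2)) *
        (Real.tanh (|x| + Real.artanh q) * (Real.cosh (|x| + Real.artanh q))⁻¹)) 1 := by
  have hdiv : HasDerivAt (fun l : ℝ => q / l) (-q) 1 := by
    simpa [div_eq_mul_inv] using (hasDerivAt_inv (one_ne_zero (α := ℝ))).const_mul q
  have hq' : q / 1 ∈ Set.Ioo (-1 : ℝ) 1 := by rw [div_one]; exact abs_lt.1 hq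
  have harg : HasDerivAt (fun l : ℝ => l * |x| + Real.artanh (q / l))
      (|x| - q / (1 - q ^ 2)) 1 := by
    refine (((hasDerivAt_id (1 : ℝ)).mul_const |x|).add
      ((hasDerivAt_artanh hq').comp 1 hdiv)).congr_deriv ?_
    rw [div_one]
    ring
  have hmul := (hasDerivAt_id (1 : ℝ)).mul ((hasDerivAt_inv_cosh _).comp 1 harg)
  refine (hmul.congr_of_eventuallyEq (Eventually.of_forall fun l => ?_)).congr_deriv ?_
  · simp [groundState, div_eq_mul_inv]
  · simp only [one_mul, div_one, Function.comp, id]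
    ring

theorem ofReal_deriv_groundState (hq : |q| < 1) (x : ℝ) :
    ((deriv (fun l => groundState q l x) 1 : ℝ) : ℂ) =
      dilationMode (Real.artanh q + q / (1 - q ^ 2)) (|x| + Real.artanh q) := by
  rw [(hasDerivAt_groundState hq x).deriv, dilationMode, th, sech]
  push_cast
  ring

end DilationMode

section GeneralizedKernel

variable {q : ℝ}

theorem reflectExt_one_comp_add (A : ℝ → ℂ) (c : ℝ) :
    reflectExt 1 (fun x => A (x + c)) = fun x => A (|x| + c) := by
  ext x
  rcases lt_or_ge x 0 with hx | hx
  · rw [reflectExt_of_neg hx, one_mul, abs_of_neg hx]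
  · rw [reflectExt_of_nonneg hx, abs_of_nonneg hx]

theorem inDomainC2_even {A A₁ A₂ : ℝ → ℂ} (hA : ∀ y, HasDerivAt A (A₁ y) y)
    (hA₁ : ∀ y, HasDerivAt A₁ (A₂ y) y) (dA : ExpDecay A) (dA₁ : ExpDecay A₁) (dA₂ : ExpDecay A₂)
    (hjump : A₁ (Real.artanh q) = -q * A (Real.artanh q)) :
    InDomainC2 q (fun x => A (|x| + Real.artanh q))
      (reflectExt (-1) fun x => A₁ (x + Real.artanh q)) fun x => A₂ (|x| + Real.artanh q) := by
  rw [← reflectExt_one_comp_add A, ← reflectExt_one_comp_add A₂]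
  refine inDomainC2_reflectExt (fun x => (hA _).comp_add_const x _)
    (fun x => (hA₁ _).comp_add_const x _) (dA.comp_add _) (dA₁.comp_add _) (dA₂.comp_add _)
    (one_mul _) ?_
  rw [zero_add, hjump]
  ring

theorem inDomainC2_zero (q : ℝ) : InDomainC2 q 0 0 fun _ => 0 :=
  ⟨InDomain.zero q, fun x _ => hasDerivAt_const x 0⟩

theorem one_sub_ofReal_sq_ne_zero (hq : |q| < 1) : 1 - (q : ℂ) ^ 2 ≠ 0 := by
  exact_mod_cast (sub_pos.2 ((sq_lt_one_iff_abs_lt_one q).2 hq)).ne'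

theorem isClassicalSolution_sech (hq : |q| < 1) :
    IsClassicalSolution q 0 0 0 0 0 (fun x => sech (|x| + Real.artanh q))
      (reflectExt (-1) fun x => -(th (x + Real.artanh q) * sech (x + Real.artanh q))) where
  fst := by simpa using inDomainC2_zero q
  snd := by
    have hquad : ExpDecay fun y => (1 - 2 * (1 - th y ^ 2)) * sech y := by
      simpa using expDecay_sech.comp_th_add_mul (P := fun t => 1 - 2 * (1 - t ^ 2)) (by fun_prop) 0
    have h := inDomainC2_even (q := q) (A₂ := fun y => (1 - 2 * (1 - th y ^ 2)) * sech y)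
      hasDerivAt_sech (fun y => (hasDerivAt_th_mul_sech y).neg.congr_deriv (by ring))
      expDecay_sech (by simpa using expDecay_th_mul_sech.const_mul (-1)) hquad
      (by simp [th_artanh hq])
    simpa using h

theorem isClassicalSolution_dilationMode (hq : |q| < 1) :
    IsClassicalSolution q 0 0 (fun x => sech (|x| + Real.artanh q))
      (fun x => dilationMode (Real.artanh q + q / (1 - q ^ 2)) (|x| + Real.artanh q))
      (reflectExt (-1) fun x =>
        dilationMode₁ (Real.artanh q + q / (1 - q ^ 2)) (x + Real.artanh q)) 0 0 where
  fst := by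
    have hquad : ExpDecay fun y => (1 - 6 * (1 - th y ^ 2)) *
        dilationMode (Real.artanh q + q / (1 - q ^ 2)) y + 2 * sech y := by
      simpa using ((expDecay_dilationMode (Real.artanh q + q / (1 - q ^ 2))).comp_th_add_mul
        (P := fun t => 1 - 6 * (1 - t ^ 2)) (by fun_prop) 0).add (expDecay_sech.const_mul 2)
    have h := inDomainC2_even (q := q) (hasDerivAt_dilationMode _) (hasDerivAt_dilationMode₁ _)
      (expDecay_dilationMode _) (expDecay_dilationMode₁ _) hquad (by
        have hne := one_sub_ofReal_sq_ne_zero hq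
        simp only [dilationMode, dilationMode₁, th_artanh hq]
        push_cast
        field_simp
        ring)
    simpa using h
  snd := by simpa using inDomainC2_zero q

theorem integral_Ioi_dilationMode_mul_sech (hq : |q| < 1) :
    ∫ x in Set.Ioi 0, dilationMode (Real.artanh q + q / (1 - q ^ 2)) (x + Real.artanh q) *
      sech (x + Real.artanh q) = 1 / 2 := by
  set s := Real.artanh q + q / (1 - q ^ 2) with hs
  have hderiv : ∀ y, HasDerivAt (fun y : ℝ => (th y + ((y : ℂ) - s) * sech y ^ 2) / 2)
      (dilationMode s y * sech y) y := fun y => by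
    refine (((hasDerivAt_th y).add ((hasDerivAt_ofReal_sub_const s y).mul
      ((hasDerivAt_sech y).pow 2))).div_const 2).congr_deriv ?_
    simp only [Pi.pow_apply, dilationMode, ← sech_sq]
    push_cast
    ring
  have hlim : Tendsto (fun y : ℝ => (th y + ((y : ℂ) - s) * sech y ^ 2) / 2) atTop
      (𝓝 (1 / 2)) := by
    have hsech := expDecay_sech.tendsto_atTop
    have h := (tendsto_th_atTop.add ((expDecay_sech.ofReal_mul.tendsto_atTop.mul hsech).sub
      ((hsech.pow 2).const_mul (s : ℂ)))).div_const 2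
    simp only [mul_zero, zero_pow two_ne_zero, sub_zero, add_zero] at h
    exact h.congr fun y => by ring
  rw [integral_Ioi_of_hasDerivAt_of_tendsto' (fun x _ => (hderiv _).comp_add_const x _)
    (((expDecay_dilationMode s).comp_add _).memLp.integrable_mul (expDecay_sech.comp_add _).memLp)
    (hlim.comp (tendsto_atTop_add_const_right _ _ tendsto_id))]
  rw [zero_add, sech_sq, th_artanh hq, hs]
  have hne := one_sub_ofReal_sq_ne_zero hq
  push_cast
  field_simp
  ring

theorem integral_dilationMode_mul_sech (hq : |q| < 1) :
    ∫ x, dilationMode (Real.artanh q + q / (1 - q ^ 2)) (|x| + Real.artanh q) *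
      sech (|x| + Real.artanh q) = 1 := by
  have h := integral_reflectExt_mul_reflectExt (one_pow 2)
    (((expDecay_dilationMode (Real.artanh q + q / (1 - q ^ 2))).comp_add
      (Real.artanh q)).memLp.integrable_mul (expDecay_sech.comp_add (Real.artanh q)).memLp)
  rw [integral_Ioi_dilationMode_mul_sech hq, mul_one_div_cancel two_ne_zero] at h
  simpa only [reflectExt_one_comp_add] using h

theorem jostB_one (y : ℝ) : jostB 1 y = 2 * sech y := by
  rw [jostB_apply, sech_eq_mul_exp, one_mul]
  ring

theorem EvenMatching.add_eq_zero {e d : ℂ} (h : EvenMatching q 1 1 e d) (hq : |q| < 1 / 100) :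
    e + d = 0 := by
  have hq1 : |q| < 1 := hq.trans (by norm_num)
  have hne : jostA₁ 1 (Real.artanh q) + q * jostA 1 (Real.artanh q) ≠ 0 := by
    have hfactor := jostA₁_add_mul 1 (Real.artanh q)
    rw [th_artanh hq1] at hfactor
    have hpos : (1 + q) * (3 - 2 * q ^ 2 - 1 ^ 2) ≠ 0 :=
      mul_ne_zero (by linarith [abs_lt.1 hq]) (by linarith [(sq_lt_one_iff_abs_lt_one q).2 hq1])
    rw [hfactor]
    exact mul_ne_zero (by exact_mod_cast hpos) (Complex.exp_ne_zero _)
  refine mul_right_cancel₀ hne ?_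
  have hfst := h.fst
  rw [jostCombA₁, jostCombA] at hfst
  linear_combination hfst

theorem IsClassicalSolution.eq_const_mul_sech {f f₁ g g₁ : ℝ → ℂ} (hq : |q| < 1 / 100)
    (h0 : q ≠ 0) (h : IsClassicalSolution q 0 0 0 f f₁ g g₁) :
    f = 0 ∧ ∃ c : ℂ, g = fun x => c * sech (|x| + Real.artanh q) := by
  have hl : (1 : ℂ) ^ 2 = 1 - 2 * 0 := by norm_num
  have hl' : (1 : ℂ) ^ 2 = 1 + 2 * 0 := by norm_num
  have hone : ‖(1 : ℂ) - 1‖ ≤ 1 / 8 := by norm_num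
  rw [← mul_zero Complex.I] at h
  obtain ⟨e, d, o, p, heven, hodd, hfg⟩ :=
    h.exists_matching hl hl' hone hone (hq.trans (by norm_num))
  obtain ⟨rfl, rfl⟩ := hodd.eq_zero (mt (jostA_mul_jostB_add_eq_zero_iff hq hl hl' hone hone).1 (by
    rw [zero_pow two_ne_zero]
    exact_mod_cast (eigSq_ne_zero hq h0).symm))
  obtain rfl : d = -e := by linear_combination heven.add_eq_zero hq
  simp only [reflectExt_one_comp_add] at hfg
  simp only [jostCombA, jostCombB, jostB_one, zero_mul, add_zero, sub_zero, reflectExt_zero,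
    Pi.zero_apply] at hfg
  refine ⟨funext fun x => ?_, Complex.I * (4 * e), funext fun x => ?_⟩
  · rw [(hfg x).1, Pi.zero_apply]
    ring
  · rw [(hfg x).2]
    ring

theorem genEigenspace_zero (hq : |q| < 1 / 100) (h0 : q ≠ 0) {V D : L2}
    (hV : V =ᵐ[volume] fun x => sech (|x| + Real.artanh q))
    (hD : D =ᵐ[volume] fun x =>
      dilationMode (Real.artanh q + q / (1 - q ^ 2)) (|x| + Real.artanh q)) :
    genEigenspace (F q) 0 = Submodule.span ℂ {(0, V), (D, 0)} ∧
    LinearIndependent ℂ ![((0, V) : L2 × L2), (D, 0)] ∧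
    (∃ h : ((0, V) : L2 × L2) ∈ (F q).domain, F q ⟨(0, V), h⟩ = 0) ∧
    (∃ h : ((D, 0) : L2 × L2) ∈ (F q).domain, F q ⟨(D, 0), h⟩ = (0, V)) := by
  have hsech := isClassicalSolution_sech (hq.trans (by norm_num : (1 / 100 : ℝ) < 1))
  have hmode := isClassicalSolution_dilationMode (hq.trans (by norm_num : (1 / 100 : ℝ) < 1))
  have hint := integral_dilationMode_mul_sech (hq.trans (by norm_num : (1 / 100 : ℝ) < 1))
  have h0' : ⇑(0 : L2) =ᵐ[volume] (0 : ℝ → ℂ) := Lp.coeFn_zero _ _ _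
  have hFV := hsech.exists_F_eq_smul (u := (0, V)) h0' hV
  have hFD := hmode.exists_F_eq (u := (D, 0)) (r := (0, V)) hD h0' h0' hV
  refine ⟨genEigenspace_eq_span_pair hFV hFD (fun u hu => ?_) fun u c hu => ?_, ?_,
    by simpa only [zero_smul] using hFV, by simpa only [zero_smul, zero_add] using hFD⟩
  · obtain ⟨f, f₁, g, g₁, huf, hug, h⟩ := exists_isClassicalSolution_of_eq_smul hu
    obtain ⟨rfl, c, rfl⟩ := h.eq_const_mul_sech hq h0
    exact Submodule.mem_span_singleton.2 ⟨c, Prod.ext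
      ((smul_zero c).trans (Lp.ext (huf.trans h0'.symm)).symm) (eq_smul_of_ae_eq hug hV).symm⟩
  · refine hsech.eq_zero_of_exists_F_eq hD h0' hmode.fst.continuous continuous_zero ?_ hu
    simp only [Pi.zero_apply, mul_zero, add_zero, hint, ne_eq, one_ne_zero, not_false_eq_true]
  · have hne := hint.trans_ne (one_ne_zero (α := ℂ))
    refine LinearIndependent.pair_iff.2 fun s t h => ⟨?_, ?_⟩
    · exact (smul_eq_zero.1 (by simpa using congrArg Prod.snd h)).resolve_right
        (ne_zero_of_integral_mul_ne_zero hV fun h =>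
          hne ((integral_congr_ae (ae_of_all _ fun x => mul_comm _ _)).trans h))
    · exact (smul_eq_zero.1 (by simpa using congrArg Prod.fst h)).resolve_right
        (ne_zero_of_integral_mul_ne_zero hD hne)

end GeneralizedKernel

section EigenvaluesNearZero

variable {q : ℝ} {l z : ℂ}

theorem isEigenvalue_of_eq_smul {E : Type*} [AddCommGroup E] [Module ℂ E] {T : E →ₗ.[ℂ] E} {w : E}
    (hw : ∃ h : w ∈ T.domain, T ⟨w, h⟩ = z • w) (h0 : w ≠ 0) : IsEigenvalue T z :=
  let ⟨h, e⟩ := hw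
  ⟨⟨w, h⟩, h0, e⟩

theorem span_singleton_eq_of_mem {E : Type*} [AddCommGroup E] [Module ℂ E] {w w' : E}
    (h : w' ∈ Submodule.span ℂ {w}) (h0 : w' ≠ 0) :
    Submodule.span ℂ {w} = Submodule.span ℂ {w'} := by
  obtain ⟨t, rfl⟩ := Submodule.mem_span_singleton.1 h
  have ht : t ≠ 0 := (smul_ne_zero_iff.1 h0).1
  exact (Submodule.span_singleton_smul_eq (IsUnit.mk0 t ht) w).symm

theorem exists_genEigenspace_zero_basis (hq : |q| < 1 / 100) (h0 : q ≠ 0) : ∃ V D : L2,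
    V =ᵐ[volume] (fun x => (groundState q 1 x : ℂ)) ∧
    D =ᵐ[volume] (fun x => ((deriv (fun l => groundState q l x) 1 : ℝ) : ℂ)) ∧
    genEigenspace (F q) 0 = Submodule.span ℂ {(0, V), (D, 0)} ∧
    LinearIndependent ℂ ![((0, V) : L2 × L2), (D, 0)] ∧
    (∃ h : ((0, V) : L2 × L2) ∈ (F q).domain, F q ⟨(0, V), h⟩ = 0) ∧
    (∃ h : ((D, 0) : L2 × L2) ∈ (F q).domain, F q ⟨(D, 0), h⟩ = (0, V)) := by
  have hq1 : |q| < 1 := hq.trans (by norm_num)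
  have hV := (isClassicalSolution_sech hq1).snd.memLp.coeFn_toLp
  have hD := (isClassicalSolution_dilationMode hq1).fst.memLp.coeFn_toLp
  refine ⟨_, _, ?_, ?_, genEigenspace_zero hq h0 hV hD⟩
  · simpa only [groundState_one] using hV
  · simpa only [ofReal_deriv_groundState hq1] using hD

/-- The eigenvalue of `-i F q` near `√q`, a square root of `eigSq q`; for `q < 0` it is the root in
the upper half-plane. -/
def eigRoot (q : ℝ) : ℂ :=
  if 0 < q then (√(|eigSq q|) : ℂ) else Complex.I * (√(|eigSq q|) : ℂ)

theorem norm_eigRoot (q : ℝ) : ‖eigRoot q‖ = √(|eigSq q|) := by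
  rw [eigRoot]
  split_ifs <;> simp [abs_of_nonneg (Real.sqrt_nonneg _)]

theorem eigRoot_sq (hq : |q| < 1 / 100) (h0 : q ≠ 0) : eigRoot q ^ 2 = eigSq q := by
  have h := Real.sq_sqrt (abs_nonneg (eigSq q))
  rw [eigRoot]
  split_ifs with hpos
  · rw [abs_of_pos (eigSq_pos hq hpos)] at *
    exact_mod_cast h
  · rw [abs_of_neg (eigSq_neg hq (lt_of_le_of_ne (not_lt.1 hpos) h0))] at *
    rw [mul_pow, Complex.I_sq, ← Complex.ofReal_pow, h, Complex.ofReal_neg, neg_one_mul, neg_neg]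

theorem eigRoot_ne_zero (hq : |q| < 1 / 100) (h0 : q ≠ 0) : eigRoot q ≠ 0 := by
  rw [← sq_eq_zero_iff.ne, eigRoot_sq hq h0]
  exact_mod_cast eigSq_ne_zero hq h0

theorem norm_eigRoot_lt (hq : |q| < 1 / 1000) : ‖eigRoot q‖ < 1 / 16 := by
  rw [norm_eigRoot, Real.sqrt_lt' (by norm_num)]
  have hsub := abs_eigSq_sub_le (hq.trans (by norm_num))
  have htri := abs_sub_abs_le_abs_sub (eigSq q) q
  have hsq := sq_abs q
  nlinarith [abs_nonneg q]

theorem norm_eigRoot_sub_sqrt_le (hq : |q| < 1 / 100) (hpos : 0 < q) :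
    ‖eigRoot q - (√q : ℂ)‖ ≤ 2 * |q| ^ (3 / 2 : ℝ) := by
  have h := abs_sqrt_abs_eigSq_sub_le hq
  rw [eigRoot, if_pos hpos, ← Complex.ofReal_sub, Complex.norm_real, Real.norm_eq_abs]
  rwa [abs_of_pos hpos] at h ⊢

theorem norm_eigRoot_sub_I_mul_sqrt_le (hq : |q| < 1 / 100) (hneg : q < 0) :
    ‖eigRoot q - Complex.I * (√(|q|) : ℂ)‖ ≤ 2 * |q| ^ (3 / 2 : ℝ) := by
  rw [eigRoot, if_neg hneg.not_gt, ← mul_sub, ← Complex.ofReal_sub, norm_mul, Complex.norm_I,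
    one_mul, Complex.norm_real, Real.norm_eq_abs]
  exact abs_sqrt_abs_eigSq_sub_le hq

theorem exists_odd_eigenpair (hq : |q| < 1 / 100) (hl : l ≠ 0) (hln : ‖l‖ ≤ 1 / 16)
    (hs : l ^ 2 = eigSq q) : ∃ wp wm : L2 × L2, wp ≠ 0 ∧ wm ≠ 0 ∧
      (∃ h : wp ∈ (F q).domain, F q ⟨wp, h⟩ = (Complex.I * l) • wp) ∧
      (∃ h : wm ∈ (F q).domain, F q ⟨wm, h⟩ = (Complex.I * -l) • wm) ∧
      genEigenspace (F q) (Complex.I * l) = Submodule.span ℂ {wp} ∧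
      genEigenspace (F q) (Complex.I * -l) = Submodule.span ℂ {wm} ∧
      IsOdd wp ∧ IsOdd wm ∧ sigma3 wp = wm ∧ sigma3 wm = wp := by
  obtain ⟨w, hw0, hodd, hw, hgen⟩ := exists_odd_eigenvector hq hl hln hs
  obtain ⟨w', -, -, -, hgen'⟩ := exists_odd_eigenvector (l := -l) hq (neg_ne_zero.2 hl)
    (by rwa [norm_neg]) (by rwa [neg_sq])
  have hσ0 : sigma3 w ≠ 0 := fun h => hw0 (by
    rw [← sigma3_sigma3 w, h]
    simp [sigma3])
  have hσ := exists_F_sigma3_eq hw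
  rw [← mul_neg] at hσ
  have hmem := mem_genEigenspace_of_eq_smul hσ
  rw [hgen'] at hmem
  exact ⟨w, sigma3 w, hw0, hσ0, hw, hσ, hgen, hgen'.trans (span_singleton_eq_of_mem hmem hσ0),
    hodd, hodd.sigma3, rfl, sigma3_sigma3 w⟩

theorem IsEigenvalue.eq_zero_or_eq (h : IsEigenvalue (F q) z) (hq : |q| < 1 / 100)
    (hz : ‖z‖ < 1 / 16) (hs : l ^ 2 = eigSq q) :
    z = 0 ∨ z = Complex.I * l ∨ z = Complex.I * -l := by
  obtain ⟨l', rfl⟩ : ∃ l', z = Complex.I * l' :=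
    ⟨-Complex.I * z, by linear_combination z * Complex.I_sq⟩
  rw [norm_mul, Complex.norm_I, one_mul] at hz
  obtain ⟨⟨u, hu⟩, hu0, hFu⟩ := h
  by_cases hl' : l' = 0
  · exact Or.inl (by rw [hl', mul_zero])
  · have hsq : l' ^ 2 = l ^ 2 := by
      rw [hs]
      by_contra hne
      exact hu0 (eq_zero_of_F_eq_smul hq hl' hz.le hne ⟨hu, hFu⟩)
    exact Or.inr ((sq_eq_sq_iff_eq_or_eq_neg.1 hsq).imp (congrArg _) (congrArg _))

theorem setOf_isEigenvalue_norm_lt_eq (hq : |q| < 1 / 100) (h0 : q ≠ 0) (hln : ‖l‖ < 1 / 16)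
    (hs : l ^ 2 = eigSq q) : {z : ℂ | IsEigenvalue (F q) z ∧ ‖z‖ < 1 / 16} =
      {0, Complex.I * l, Complex.I * -l} := by
  obtain ⟨V, D, -, -, -, hind, hFV, -⟩ := exists_genEigenspace_zero_basis hq h0
  have hl : l ≠ 0 := by
    rintro rfl
    rw [zero_pow two_ne_zero] at hs
    exact eigSq_ne_zero hq h0 (by exact_mod_cast hs.symm)
  obtain ⟨wp, wm, hwp, hwm, hFp, hFm, -⟩ := exists_odd_eigenpair hq hl hln.le hs
  have hV0 : ((0, V) : L2 × L2) ≠ 0 := hind.ne_zero 0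
  refine Set.Subset.antisymm (fun z hz => hz.1.eq_zero_or_eq hq hz.2 hs) ?_
  rintro z (rfl | rfl | rfl)
  · exact ⟨isEigenvalue_of_eq_smul (by simpa only [zero_smul] using hFV) hV0, by norm_num⟩
  · exact ⟨isEigenvalue_of_eq_smul hFp hwp, by rwa [norm_mul, Complex.norm_I, one_mul]⟩
  · exact ⟨isEigenvalue_of_eq_smul hFm hwm, by rwa [norm_mul, Complex.norm_I, one_mul, norm_neg]⟩

end EigenvaluesNearZero

end DeltaNLS

end

theorem mainTheorem8 :
    ∃ q₀ > (0 : ℝ), ∃ δ > (0 : ℝ), ∃ C > (0 : ℝ), ∀ q : ℝ, 0 < |q| → |q| < q₀ →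
      (∀ x : ℝ, DifferentiableAt ℝ (fun l => DeltaNLS.groundState q l x) 1) ∧
      ∃ V D : DeltaNLS.L2,
        V =ᵐ[volume] (fun x : ℝ => (DeltaNLS.groundState q 1 x : ℂ)) ∧
        D =ᵐ[volume] (fun x : ℝ => ((deriv (fun l => DeltaNLS.groundState q l x) 1 : ℝ) : ℂ)) ∧
        -- the generalized kernel
        DeltaNLS.genEigenspace (DeltaNLS.F q) 0 = Submodule.span ℂ {(0, V), (D, 0)} ∧
        LinearIndependent ℂ ![((0, V) : DeltaNLS.L2 × DeltaNLS.L2), (D, 0)] ∧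
        (∃ h : ((0, V) : DeltaNLS.L2 × DeltaNLS.L2) ∈ (DeltaNLS.F q).domain, DeltaNLS.F q ⟨(0, V), h⟩ = 0) ∧
        (∃ h : ((D, 0) : DeltaNLS.L2 × DeltaNLS.L2) ∈ (DeltaNLS.F q).domain, DeltaNLS.F q ⟨(D, 0), h⟩ = (0, V)) ∧
        -- the two further eigenvalues near zero
        ∃ lp lm : ℂ, lp ≠ 0 ∧ lm ≠ 0 ∧ lp ≠ lm ∧
          {z : ℂ | DeltaNLS.IsEigenvalue (DeltaNLS.F q) z ∧ ‖z‖ < δ} =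
            {0, Complex.I * lp, Complex.I * lm} ∧
          (0 < q → ‖lp - (Real.sqrt q : ℂ)‖ ≤ C * |q| ^ (3 / 2 : ℝ) ∧
            ‖lm - -(Real.sqrt q : ℂ)‖ ≤ C * |q| ^ (3 / 2 : ℝ)) ∧
          (q < 0 → ‖lp - Complex.I * (Real.sqrt |q| : ℂ)‖ ≤ C * |q| ^ (3 / 2 : ℝ) ∧
            ‖lm - -(Complex.I * (Real.sqrt |q| : ℂ))‖ ≤ C * |q| ^ (3 / 2 : ℝ)) ∧
          -- their eigenfunctions
          ∃ wp wm : DeltaNLS.L2 × DeltaNLS.L2, wp ≠ 0 ∧ wm ≠ 0 ∧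
            (∃ h : wp ∈ (DeltaNLS.F q).domain,
              DeltaNLS.F q ⟨wp, h⟩ = (Complex.I * lp) • wp) ∧
            (∃ h : wm ∈ (DeltaNLS.F q).domain,
              DeltaNLS.F q ⟨wm, h⟩ = (Complex.I * lm) • wm) ∧
            DeltaNLS.genEigenspace (DeltaNLS.F q) (Complex.I * lp) = Submodule.span ℂ {wp} ∧
            DeltaNLS.genEigenspace (DeltaNLS.F q) (Complex.I * lm) = Submodule.span ℂ {wm} ∧
            DeltaNLS.IsOdd wp ∧ DeltaNLS.IsOdd wm ∧
            DeltaNLS.sigma3 wp = wm ∧ DeltaNLS.sigma3 wm = wp := by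
  refine ⟨1 / 1000, by norm_num, 1 / 16, by norm_num, 2, by norm_num, fun q hq0 hq => ?_⟩
  have h0 : q ≠ 0 := abs_pos.1 hq0
  have hq' : |q| < 1 / 100 := hq.trans (by norm_num)
  have hdiff := fun x =>
    (DeltaNLS.hasDerivAt_groundState (hq.trans (by norm_num)) x).differentiableAt
  obtain ⟨V, D, hV, hD, hker, hind, hFV, hFD⟩ := DeltaNLS.exists_genEigenspace_zero_basis hq' h0
  have hsq := DeltaNLS.eigRoot_sq hq' h0
  have hne := DeltaNLS.eigRoot_ne_zero hq' h0
  have hlt := DeltaNLS.norm_eigRoot_lt hq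
  refine ⟨hdiff, V, D, hV, hD, hker, hind, hFV, hFD, DeltaNLS.eigRoot q, -DeltaNLS.eigRoot q, hne,
    neg_ne_zero.2 hne, fun h => hne (self_eq_neg.1 h),
    DeltaNLS.setOf_isEigenvalue_norm_lt_eq hq' h0 hlt hsq, fun hpos => ?_, fun hneg => ?_,
    DeltaNLS.exists_odd_eigenpair hq' hne hlt.le hsq⟩
  · rw [← neg_sub', norm_neg, and_self]
    exact DeltaNLS.norm_eigRoot_sub_sqrt_le hq' hpos
  · rw [← neg_sub', norm_neg, and_self]
    exact DeltaNLS.norm_eigRoot_sub_I_mul_sqrt_le hq' hneg
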